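/- For a measurable set $G\subset\mathbb R^2$ let $|G|$ denote its Lebesgue measure, let $$P(G)=\sup\Big\{\int_G \operatorname{div}\varphi\,dx \;:\; \varphi\in C^1_c(\mathbb R^2;\mathbb R^2),\ |\varphi|\le 1\Big\}\in[0,\infty]$$ be its perimeter, and let ${\rm cov}(G)$ be its convex hull. Let $E\subset\mathbb R^2$ be non-empty, open, connected and bounded. Then $$\frac{P(E)}{|E|^{1/2}}-\frac{P({\rm cov}(E))}{|{\rm cov}(E)|^{1/2}}\;\ge\;\sqrt{\pi}\,\frac{|{\rm cov}(E)\setminus E|}{|{\rm cov}(E)|^{1/2}\,|E|^{1/2}},$$ where $P({\rm cov}(E))<\infty$ and the left-hand side is $+\infty$ if $P(E)=\infty$. In addition, suppose that $|E|=\pi$. For any point $x_0\in E$ let $$F=x_0+\theta\,({\rm cov}(E)-x_0),\qquad \theta=\Big(\frac{|E|}{|{\rm cov}(E)|}\Big)^{1/2},$$ be the dilation of ${\rm cov}(E)$ with centre $x_0$ and ratio $\theta$. Then $|F|=|E|$ and $$P(E)-P(F)\;\ge\;\frac{1}{2\sqrt2}\,|E\Delta F| ,$$ where $E\Delta F=(E\cup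 F)\setminus(E\cap F)$. -/

import Mathlib

open MeasureTheory
open scoped ENNReal

noncomputable section

/-- The divergence `∑ i, ∂ᵢ φᵢ` of a vector field on `ℝⁿ`. -/
def divergence {n : ℕ} (φ : EuclideanSpace ℝ (Fin n) → EuclideanSpace ℝ (Fin n))
    (x : EuclideanSpace ℝ (Fin n)) : ℝ :=
  ∑ i, (fderiv ℝ φ x (EuclideanSpace.single i 1)) i

/-- The (De Giorgi) perimeter of a measurable set `E ⊆ ℝⁿ`: the supremum of `∫_E div φ` over all
compactly supported `C¹` vector fields `φ` with Euclidean norm at most `1` everywhere. It takes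
values in `[0, ∞]`; since `φ = 0` is admissible (and `-φ` is when `φ` is), applying
`ENNReal.ofReal` to the integral does not change the supremum. -/
def perimeter {n : ℕ} (E : Set (EuclideanSpace ℝ (Fin n))) : ℝ≥0∞ :=
  ⨆ (φ : EuclideanSpace ℝ (Fin n) → EuclideanSpace ℝ (Fin n)) (_ : ContDiff ℝ 1 φ)
    (_ : HasCompactSupport φ) (_ : ∀ x, ‖φ x‖ ≤ 1), ENNReal.ofReal (∫ x in E, divergence φ x)

/-- The image of the convex hull of the planar set `E` under the dilation with centre `x₀` and
ratio `(|E| / |cov(E)|)^{1/2}`. -/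
def rescaledHull (E : Set (EuclideanSpace ℝ (Fin 2))) (x₀ : EuclideanSpace ℝ (Fin 2)) :
    Set (EuclideanSpace ℝ (Fin 2)) :=
  AffineMap.homothety x₀ (Real.sqrt (volume.real E / volume.real (convexHull ℝ E))) ''
    convexHull ℝ E

end

/-!
The planar fact behind both inequalities is that convexification of a connected open set `E` does
not increase its perimeter: `P(C) ≤ P(E)` for `C = convexHull ℝ E`. Together with the isoperimetric
inequality `2 √π |C|^{1/2} ≤ P(C)` for the convex set `C` this leaves an elementary computation with
`|E| ≤ |C|`; for the second inequality one uses in addition that the dilate `F` of `C` is contained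
in `C`, has the area of `E`, and has perimeter at most `θ P(C)`.

Both facts are obtained from the shadows (orthogonal projections to lines) of the sets, through a
discrete form of Cauchy's formula. Choose finitely many unit vectors `u` and a weight `c` such that
`(1 - δ) ‖v‖ ≤ c ∑ |⟨u, v⟩| ≤ ‖v‖` for all `v` (`exists_directions`), write `w_u(A)` for the length of
the projection of `A` along `u`, and set `q = 2 c ∑ w_u(E)`.

* `q ≤ P(E)` (`ofReal_mul_sum_volume_shadow_le_perimeter`). For each `u` there is a scalar test
  function `g_u` with `|g_u| ≤ 1` whose derivative along `u` has integral over `E` close to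
  `2 w_u(E)` (`exists_test_function`), and the field `c ∑ g_u u` has norm at most one because
  `c ∑ |⟨u, ·⟩| ≤ ‖·‖`.
* `E` and `C` have the same shadows, since projections of connected sets are intervals
  (`shadow_convexHull`).
* For convex `C`, adding a segment `[-r u, r u]` increases the area by at most `2 r w_u(C)`. A disc of
  radius `t` lies in a Minkowski sum of such segments with `r = c t / (1 - δ)`, so that
  `|C + tB| ≤ |C| + t q / (1 - δ) + O(t²)` (`exists_volume_add_closedBall_le`).
* Displacing `C` by `x ↦ x + t φ x` gives `|C| + t ∫_C div φ - O(t²) ≤ |C + tB|` for admissible `φ`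
  (`exists_le_volume_add_closedBall`), whence `P(C) ≤ q / (1 - δ)`.
* The Brunn–Minkowski inequality gives `(|C|^{1/2} + t √π)² ≤ |C + tB|` (`sq_sqrt_volume_add_le`),
  whence `2 √π |C|^{1/2} ≤ q / (1 - δ)`.

Letting `δ → 0` yields `P(C) ≤ P(E)`, and the isoperimetric inequality on applying the same to `C`
in place of `E`.
-/

noncomputable section

open Set Metric Pointwise

/-! ### Rotated coordinates in the plane -/

/-- The unit vector at angle `α`. -/
def dir (α : ℝ) : EuclideanSpace ℝ (Fin 2) := !₂[Real.cos α, Real.sin α]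

/-- The coordinate orthogonal to `dir α`. -/
def transverse (α : ℝ) : EuclideanSpace ℝ (Fin 2) →L[ℝ] ℝ :=
  Real.sin α • EuclideanSpace.proj 0 - Real.cos α • EuclideanSpace.proj 1

lemma transverse_apply (α : ℝ) (x : EuclideanSpace ℝ (Fin 2)) :
    transverse α x = Real.sin α * x 0 - Real.cos α * x 1 := by
  simp [transverse]

/-- The coordinate along `dir α`. -/
def axial (α : ℝ) : EuclideanSpace ℝ (Fin 2) →L[ℝ] ℝ :=
  Real.cos α • EuclideanSpace.proj 0 + Real.sin α • EuclideanSpace.proj 1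

lemma axial_apply (α : ℝ) (x : EuclideanSpace ℝ (Fin 2)) :
    axial α x = Real.cos α * x 0 + Real.sin α * x 1 := by
  simp [axial]

/-- The rotation taking the standard basis to the frame whose second vector is `dir α` and whose
coordinates are `transverse α` and `axial α`. -/
def frameRotation (α : ℝ) : EuclideanSpace ℝ (Fin 2) ≃ₗᵢ[ℝ] EuclideanSpace ℝ (Fin 2) :=
  LinearIsometry.toLinearIsometryEquiv
    (⟨{ toFun := fun x => !₂[Real.sin α * x 0 + Real.cos α * x 1,
          -(Real.cos α * x 0) + Real.sin α * x 1]
        map_add' := fun x y => by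
          ext i; fin_cases i <;> simp <;> ring
        map_smul' := fun a x => by
          ext i; fin_cases i <;> simp <;> ring }, fun x => by
        rw [EuclideanSpace.norm_eq, EuclideanSpace.norm_eq]
        congr 1
        simp only [Fin.sum_univ_two, Real.norm_eq_abs, sq_abs]
        simp
        linear_combination (x 0 ^ 2 + x 1 ^ 2) * Real.sin_sq_add_cos_sq α⟩ :
      EuclideanSpace ℝ (Fin 2) →ₗᵢ[ℝ] EuclideanSpace ℝ (Fin 2)) rfl

/-- The orthonormal chart `(s, t) ↦ s n + t u`, where `u = dir α` and `n ⟂ u`. -/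
def chart (α : ℝ) : ℝ × ℝ ≃ᵐ EuclideanSpace ℝ (Fin 2) :=
  (MeasurableEquiv.finTwoArrow.symm.trans (MeasurableEquiv.toLp 2 (Fin 2 → ℝ))).trans
    (frameRotation α).toHomeomorph.toMeasurableEquiv

lemma chart_apply (α s t : ℝ) : chart α (s, t) =
    !₂[Real.sin α * s + Real.cos α * t, -(Real.cos α * s) + Real.sin α * t] := rfl

lemma measurePreserving_chart (α : ℝ) : MeasurePreserving (chart α) :=
  (((volume_preserving_finTwoArrow ℝ).symm _).trans (PiLp.volume_preserving_toLp (Fin 2))).trans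
    (frameRotation α).measurePreserving

lemma continuous_chart (α : ℝ) : Continuous (chart α) := by
  have : (chart α : ℝ × ℝ → _) = fun p => !₂[Real.sin α * p.1 + Real.cos α * p.2,
      -(Real.cos α * p.1) + Real.sin α * p.2] := rfl
  rw [this]
  refine (PiLp.continuous_toLp 2 _).comp ?_
  refine continuous_pi fun i => ?_
  fin_cases i <;> simp <;> fun_prop

@[simp] lemma transverse_chart (α s t : ℝ) : transverse α (chart α (s, t)) = s := by
  simp [transverse_apply, chart_apply]
  linear_combination s * Real.sin_sq_add_cos_sq α

@[simp] lemma axial_chart (α s t : ℝ) : axial α (chart α (s, t)) = t := by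
  simp [axial_apply, chart_apply]
  linear_combination t * Real.sin_sq_add_cos_sq α

@[simp] lemma chart_transverse_axial (α : ℝ) (x : EuclideanSpace ℝ (Fin 2)) :
    chart α (transverse α x, axial α x) = x := by
  ext i
  fin_cases i
  · simp [axial_apply, transverse_apply, chart_apply]
    linear_combination x 0 * Real.sin_sq_add_cos_sq α
  · simp [axial_apply, transverse_apply, chart_apply]
    linear_combination x 1 * Real.sin_sq_add_cos_sq α

lemma norm_dir (α : ℝ) : ‖dir α‖ = 1 := by
  rw [EuclideanSpace.norm_eq]
  simp [dir, Fin.sum_univ_two]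

lemma axial_eq_inner (α : ℝ) (x : EuclideanSpace ℝ (Fin 2)) : axial α x = inner ℝ (dir α) x := by
  simp [axial_apply, dir, PiLp.inner_apply, Fin.sum_univ_two, mul_comm]

@[simp] lemma axial_dir (α : ℝ) : axial α (dir α) = 1 := by
  rw [axial_eq_inner, real_inner_self_eq_norm_sq, norm_dir, one_pow]

@[simp] lemma transverse_dir (α : ℝ) : transverse α (dir α) = 0 := by
  simp [transverse_apply, dir]; ring

lemma abs_transverse_le (α : ℝ) (x : EuclideanSpace ℝ (Fin 2)) : |transverse α x| ≤ ‖x‖ := by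
  rw [EuclideanSpace.norm_eq, Fin.sum_univ_two]
  apply Real.abs_le_sqrt
  rw [transverse_apply]
  simp only [Real.norm_eq_abs, sq_abs]
  nlinarith [sq_nonneg (Real.cos α * x 0 + Real.sin α * x 1), Real.sin_sq_add_cos_sq α]

lemma chart_add_dir (α s t r : ℝ) : chart α (s, t + r) = chart α (s, t) + r • dir α := by
  ext i
  fin_cases i <;> simp [chart_apply, dir] <;> ring

/-- Fubini's theorem along lines parallel to `dir α`. -/
lemma volume_eq_lintegral_chord (α : ℝ) {A : Set (EuclideanSpace ℝ (Fin 2))}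
    (hA : MeasurableSet A) : volume A = ∫⁻ s, volume {t | chart α (s, t) ∈ A} := by
  rw [← (measurePreserving_chart α).measure_preimage hA.nullMeasurableSet, Measure.volume_eq_prod,
    Measure.prod_apply ((chart α).measurable hA)]
  rfl

lemma measurable_volume_chord (α : ℝ) {A : Set (EuclideanSpace ℝ (Fin 2))}
    (hA : MeasurableSet A) : Measurable fun s => volume {t | chart α (s, t) ∈ A} :=
  measurable_measure_prodMk_left ((chart α).measurable hA)

/-! ### Shadows of planar sets -/

/-- The orthogonal projection of `A` along `dir α`, as a subset of the line. -/
def shadow (α : ℝ) (A : Set (EuclideanSpace ℝ (Fin 2))) : Set ℝ := transverse α '' A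

lemma mem_shadow_iff {α s : ℝ} {A : Set (EuclideanSpace ℝ (Fin 2))} :
    s ∈ shadow α A ↔ ∃ t, chart α (s, t) ∈ A := by
  constructor
  · rintro ⟨x, hx, rfl⟩
    exact ⟨axial α x, by simpa⟩
  · rintro ⟨t, ht⟩
    exact ⟨_, ht, by simp⟩

lemma isOpen_shadow (α : ℝ) {A : Set (EuclideanSpace ℝ (Fin 2))} (hA : IsOpen A) :
    IsOpen (shadow α A) := by
  have : shadow α A = ⋃ t, (fun s => chart α (s, t)) ⁻¹' A := by
    ext s; simp [mem_shadow_iff]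
  rw [this]
  exact isOpen_iUnion fun t => hA.preimage ((continuous_chart α).comp (by fun_prop))

lemma volume_shadow_ne_top (α : ℝ) {A : Set (EuclideanSpace ℝ (Fin 2))}
    (hA : Bornology.IsBounded A) : volume (shadow α A) ≠ ∞ :=
  ((transverse α).lipschitz.isBounded_image hA).measure_lt_top.ne

/-- A connected planar set has the same shadows as its convex hull. -/
lemma shadow_convexHull (α : ℝ) {A : Set (EuclideanSpace ℝ (Fin 2))} (hA : IsConnected A) :
    shadow α (convexHull ℝ A) = shadow α A := by
  have h := (transverse α).toLinearMap.image_convexHull A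
  have hc : Convex ℝ (transverse α '' A) :=
    (hA.isPreconnected.image _ (transverse α).continuous.continuousOn).ordConnected.convex
  simp only [ContinuousLinearMap.coe_coe] at h
  rw [shadow, h, hc.convexHull_eq, shadow]

/-! ### Growth of area under addition of a zonotope -/

/-- Fattening a bounded interval by `r` on both sides adds at most `2r` to its length. -/
lemma volume_add_Icc_le {I : Set ℝ} (hI : I.OrdConnected) (hb : Bornology.IsBounded I)
    (hne : I.Nonempty) {r : ℝ} (hr : 0 ≤ r) :
    volume (I + Icc (-r) r) ≤ volume I + ENNReal.ofReal (2 * r) := by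
  have hsub : I + Icc (-r) r ⊆ Icc (sInf I - r) (sSup I + r) := by
    rintro _ ⟨x, hx, a, ha, rfl⟩
    have h1 := csInf_le hb.bddBelow hx
    have h2 := le_csSup hb.bddAbove hx
    exact ⟨by simp only; linarith [ha.1], by simp only; linarith [ha.2]⟩
  have hIoo : Ioo (sInf I) (sSup I) ⊆ I := by
    intro x hx
    obtain ⟨y, hy, hyx⟩ := exists_lt_of_csInf_lt hne hx.1
    obtain ⟨z, hz, hxz⟩ := exists_lt_of_lt_csSup hne hx.2
    exact hI.out hy hz ⟨hyx.le, hxz.le⟩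
  have hle : sInf I ≤ sSup I := by
    obtain ⟨x, hx⟩ := hne
    exact (csInf_le hb.bddBelow hx).trans (le_csSup hb.bddAbove hx)
  calc volume (I + Icc (-r) r) ≤ volume (Icc (sInf I - r) (sSup I + r)) := measure_mono hsub
    _ = ENNReal.ofReal (sSup I - sInf I) + ENNReal.ofReal (2 * r) := by
      rw [Real.volume_Icc, ← ENNReal.ofReal_add (by linarith) (by linarith)]
      congr 1; ring
    _ ≤ _ := by
      gcongr
      rw [← Real.volume_Ioo]
      exact measure_mono hIoo

/-- The segment from `-r • dir α` to `r • dir α`. -/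
def centredSegment (α r : ℝ) : Set (EuclideanSpace ℝ (Fin 2)) :=
  (fun a : ℝ => a • dir α) '' Icc (-r) r

lemma chord_add_centredSegment (α r s : ℝ) (A : Set (EuclideanSpace ℝ (Fin 2))) :
    {t | chart α (s, t) ∈ A + centredSegment α r} =
      {t | chart α (s, t) ∈ A} + Icc (-r) r := by
  ext t
  constructor
  · rintro ⟨x, hx, _, ⟨a, ha, rfl⟩, hxa⟩
    refine ⟨t - a, ?_, a, ha, by simp⟩
    have : x = chart α (s, t - a) := by
      rw [sub_eq_add_neg, chart_add_dir, ← hxa]; simp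
    simpa [← this] using hx
  · rintro ⟨t', ht', a, ha, rfl⟩
    exact ⟨_, ht', _, ⟨a, ha, rfl⟩, (chart_add_dir α s t' a).symm⟩

lemma ordConnected_chord (α s : ℝ) {A : Set (EuclideanSpace ℝ (Fin 2))} (hA : Convex ℝ A) :
    {t | chart α (s, t) ∈ A}.OrdConnected := by
  have h : {t | chart α (s, t) ∈ A} =
      (AffineMap.lineMap (chart α (s, 0)) (chart α (s, 0) + dir α) : ℝ →ᵃ[ℝ] _) ⁻¹' A := by
    ext t
    have := chart_add_dir α s 0 t
    simp [AffineMap.lineMap_apply, zero_add] at this ⊢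
    rw [this, add_comm]
  rw [h]
  exact (hA.affine_preimage _).ordConnected

lemma isBounded_chord (α s : ℝ) {A : Set (EuclideanSpace ℝ (Fin 2))}
    (hA : Bornology.IsBounded A) : Bornology.IsBounded {t | chart α (s, t) ∈ A} :=
  ((axial α).lipschitz.isBounded_image hA).subset fun t ht => ⟨_, ht, by simp⟩

lemma volume_add_centredSegment_le (α : ℝ) {r : ℝ} (hr : 0 ≤ r)
    {A : Set (EuclideanSpace ℝ (Fin 2))} (hA : IsOpen A) (hc : Convex ℝ A)
    (hb : Bornology.IsBounded A) :
    volume (A + centredSegment α r) ≤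
      volume A + ENNReal.ofReal (2 * r) * volume (shadow α A) := by
  have hs := (isOpen_shadow α hA).measurableSet
  rw [volume_eq_lintegral_chord α hA.measurableSet,
    volume_eq_lintegral_chord α (hA.add_right).measurableSet,
    ← lintegral_indicator_const hs, ← lintegral_add_right _ (measurable_const.indicator hs)]
  refine lintegral_mono fun s => ?_
  simp only
  rw [chord_add_centredSegment]
  by_cases h : s ∈ shadow α A
  · rw [indicator_of_mem h]
    exact volume_add_Icc_le (ordConnected_chord α s hc) (isBounded_chord α s hb)
      (mem_shadow_iff.1 h) hr
  · have : {t | chart α (s, t) ∈ A} = ∅ := by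
      ext t
      simpa using fun ht => h (mem_shadow_iff.2 ⟨t, ht⟩)
    simp [this]

/-- The Minkowski sum of the segments `[-r u, r u]` over the directions `u = dir (α i)`, `i ∈ s`. -/
def zonotope {ι : Type*} (α : ι → ℝ) (s : Finset ι) (r : ℝ) : Set (EuclideanSpace ℝ (Fin 2)) :=
  ∑ i ∈ s, centredSegment (α i) r

lemma isCompact_centredSegment (α r : ℝ) : IsCompact (centredSegment α r) :=
  isCompact_Icc.image (by fun_prop)

lemma convex_centredSegment (α r : ℝ) : Convex ℝ (centredSegment α r) :=
  (convex_Icc _ _).is_linear_image ⟨fun a b => add_smul a b _, fun a b => by simp [mul_smul]⟩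

lemma isCompact_zonotope {ι : Type*} (α : ι → ℝ) (s : Finset ι) (r : ℝ) :
    IsCompact (zonotope α s r) := by
  classical
  induction s using Finset.induction_on with
  | empty => simp [zonotope]
  | insert j s hj ih =>
    rw [zonotope, Finset.sum_insert hj]
    exact (isCompact_centredSegment _ _).add ih

lemma convex_zonotope {ι : Type*} (α : ι → ℝ) (s : Finset ι) (r : ℝ) :
    Convex ℝ (zonotope α s r) := by
  classical
  induction s using Finset.induction_on with
  | empty => simpa [zonotope] using convex_zero
  | insert j s hj ih =>
    rw [zonotope, Finset.sum_insert hj]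
    exact (convex_centredSegment _ _).add ih

lemma zonotope_subset_closedBall {ι : Type*} (α : ι → ℝ) (s : Finset ι) (r : ℝ) :
    zonotope α s r ⊆ closedBall 0 (r * s.card) := by
  classical
  induction s using Finset.induction_on with
  | empty => simp [zonotope]
  | insert j s hj ih =>
    rw [zonotope, Finset.sum_insert hj, Finset.card_insert_of_notMem hj]
    rintro _ ⟨_, ⟨a, ha, rfl⟩, z, hz, rfl⟩
    have h1 := mem_closedBall_zero_iff.1 (ih hz)
    have h2 : ‖a • dir (α j)‖ ≤ r := by
      rw [norm_smul, norm_dir, mul_one]; exact abs_le.2 ha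
    rw [mem_closedBall_zero_iff]
    push_cast
    exact (norm_add_le _ _).trans (by linarith)

lemma volume_shadow_add_le (α : ℝ) {r : ℝ} (hr : 0 ≤ r) {A B : Set (EuclideanSpace ℝ (Fin 2))}
    (hc : Convex ℝ A) (hb : Bornology.IsBounded A) (hne : A.Nonempty) (hB : B ⊆ closedBall 0 r) :
    volume (shadow α (A + B)) ≤ volume (shadow α A) + ENNReal.ofReal (2 * r) := by
  refine le_trans (measure_mono ?_) (volume_add_Icc_le (I := shadow α A) ?_ ?_ ?_ hr)
  · rintro _ ⟨_, ⟨x, hx, y, hy, rfl⟩, rfl⟩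
    refine ⟨_, ⟨x, hx, rfl⟩, _, ?_, (map_add _ _ _).symm⟩
    exact abs_le.1 ((abs_transverse_le α y).trans (mem_closedBall_zero_iff.1 (hB hy)))
  · exact (hc.linear_image (transverse α).toLinearMap).ordConnected
  · exact (transverse α).lipschitz.isBounded_image hb
  · exact hne.image _

/-- First-order growth of area when a zonotope of size `r` is added to a convex set: the linear
coefficient is governed by the shadows, the remainder is quadratic in `r`. -/
lemma volume_add_zonotope_le {ι : Type*} (α : ι → ℝ) (s : Finset ι) {r : ℝ} (hr : 0 ≤ r)
    {A : Set (EuclideanSpace ℝ (Fin 2))} (hA : IsOpen A) (hc : Convex ℝ A)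
    (hb : Bornology.IsBounded A) (hne : A.Nonempty) :
    volume (A + zonotope α s r) ≤ volume A +
      ENNReal.ofReal (2 * r) * ∑ i ∈ s, volume (shadow (α i) A) +
      ENNReal.ofReal (4 * r ^ 2 * s.card ^ 2) := by
  classical
  induction s using Finset.induction_on with
  | empty => simp [zonotope]
  | insert j s hj ih =>
    have h1 : A + zonotope α (insert j s) r = (A + zonotope α s r) + centredSegment (α j) r := by
      simp only [zonotope, Finset.sum_insert hj]
      rw [add_assoc, add_comm (centredSegment (α j) r)]
    have h2 := volume_add_centredSegment_le (α j) hr (A := A + zonotope α s r) hA.add_right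
      (hc.add (convex_zonotope α s r)) (hb.add (isCompact_zonotope α s r).isBounded)
    have h3 := volume_shadow_add_le (α j) (by positivity) hc hb hne
      (zonotope_subset_closedBall α s r)
    rw [h1, Finset.sum_insert hj, Finset.card_insert_of_notMem hj]
    calc _ ≤ (volume A + ENNReal.ofReal (2 * r) * ∑ i ∈ s, volume (shadow (α i) A) +
          ENNReal.ofReal (4 * r ^ 2 * s.card ^ 2)) + ENNReal.ofReal (2 * r) *
          (volume (shadow (α j) A) + ENNReal.ofReal (2 * (r * s.card))) :=
          h2.trans (add_le_add ih (by gcongr))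
      _ = volume A + ENNReal.ofReal (2 * r) *
          (volume (shadow (α j) A) + ∑ i ∈ s, volume (shadow (α i) A)) +
          ENNReal.ofReal (4 * r ^ 2 * s.card ^ 2 + 2 * r * (2 * (r * s.card))) := by
        rw [ENNReal.ofReal_add (by positivity) (by positivity),
          ENNReal.ofReal_mul (p := 2 * r) (by positivity)]
        ring
      _ ≤ _ := by
        gcongr
        push_cast
        nlinarith [sq_nonneg r, mul_nonneg (sq_nonneg r) (Nat.cast_nonneg (α := ℝ) s.card)]

/-! ### Area swept by a small displacement -/

/-- The expansion of `det (1 + t L)` in the plane, with the trace written as in `divergence`. -/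
lemma det_one_add_smul (L : EuclideanSpace ℝ (Fin 2) →L[ℝ] EuclideanSpace ℝ (Fin 2)) (t : ℝ) :
    (ContinuousLinearMap.id ℝ _ + t • L).det =
      1 + t * (∑ i, L (EuclideanSpace.single i 1) i) + t ^ 2 * L.det := by
  have key : ∀ M : EuclideanSpace ℝ (Fin 2) →L[ℝ] EuclideanSpace ℝ (Fin 2), M.det =
      M (EuclideanSpace.single 0 1) 0 * M (EuclideanSpace.single 1 1) 1 -
      M (EuclideanSpace.single 1 1) 0 * M (EuclideanSpace.single 0 1) 1 := by
    intro M
    rw [ContinuousLinearMap.det, ← LinearMap.det_toMatrix (PiLp.basisFun 2 ℝ (Fin 2)),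
      Matrix.det_fin_two]
    simp [LinearMap.toMatrix_apply]
  rw [key, key, Fin.sum_univ_two]
  simp
  ring

/-- Moving a bounded measurable set along the flow `x ↦ x + t φ x` shows that its `t`-neighbourhood
has area at least `|A| + t ∫_A div φ - O(t²)`. -/
lemma exists_le_volume_add_closedBall {φ : EuclideanSpace ℝ (Fin 2) → EuclideanSpace ℝ (Fin 2)}
    (hφ : ContDiff ℝ 1 φ) (hsupp : HasCompactSupport φ) (hle : ∀ x, ‖φ x‖ ≤ 1)
    {A : Set (EuclideanSpace ℝ (Fin 2))} (hA : MeasurableSet A) (hfin : volume A ≠ ∞) :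
    ∃ K : ℝ, ∃ t₀ > 0, ∀ t, 0 < t → t < t₀ →
      ENNReal.ofReal (volume.real A + t * (∫ x in A, divergence φ x) - K * t ^ 2) ≤
        volume (A + closedBall 0 t) := by
  obtain ⟨C, hC⟩ := hφ.lipschitzWith_of_hasCompactSupport hsupp one_ne_zero
  have hdc : Continuous fun x => (fderiv ℝ φ x) := hφ.continuous_fderiv one_ne_zero
  have hdivc : Continuous (divergence φ) := by unfold divergence; fun_prop
  have hdetc : Continuous fun x => (fderiv ℝ φ x).det :=
    ContinuousLinearMap.continuous_det.comp hdc
  have hfs : HasCompactSupport (fderiv ℝ φ) := hsupp.fderiv ℝ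
  have hdivs : HasCompactSupport (divergence φ) := by
    refine hfs.comp_left (g := fun L : EuclideanSpace ℝ (Fin 2) →L[ℝ] EuclideanSpace ℝ (Fin 2) =>
      ∑ i, (L (EuclideanSpace.single i 1)) i) (by simp)
  have hdets : HasCompactSupport fun x => (fderiv ℝ φ x).det := by
    refine hfs.comp_left (g := ContinuousLinearMap.det) ?_
    rw [ContinuousLinearMap.det]; simp
  have hidiv := (hdivc.integrable_of_hasCompactSupport (μ := volume) hdivs).integrableOn (s := A)
  have hidet := (hdetc.integrable_of_hasCompactSupport (μ := volume) hdets).integrableOn (s := A)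
  refine ⟨-∫ x in A, (fderiv ℝ φ x).det, 1 / (C + 1), by positivity, fun t ht htlt => ?_⟩
  set T : EuclideanSpace ℝ (Fin 2) → EuclideanSpace ℝ (Fin 2) := fun x => x + t • φ x with hT
  have hTd : ∀ x, HasFDerivAt T (ContinuousLinearMap.id ℝ _ + t • fderiv ℝ φ x) x := fun x =>
    (hasFDerivAt_id x).add (((hφ.differentiable one_ne_zero) x).hasFDerivAt.const_smul t)
  -- `T` is injective because `t φ` is a contraction
  have hinj : Function.Injective T := by
    intro x y hxy
    have h1 : x - y = t • (φ y - φ x) := by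
      simp only [hT] at hxy
      rw [smul_sub, sub_eq_sub_iff_add_eq_add]
      rw [hxy, add_comm]
    have h2 : ‖x - y‖ ≤ t * (C * ‖x - y‖) := by
      conv_lhs => rw [h1]
      rw [norm_smul, Real.norm_of_nonneg ht.le, ← norm_neg, neg_sub]
      gcongr
      simpa [dist_eq_norm] using hC.dist_le_mul x y
    have h3 : t * (C + 1) < 1 := by
      rwa [lt_div_iff₀ (by positivity)] at htlt
    have h4 : ‖x - y‖ = 0 := by
      by_contra h
      have hp : 0 < ‖x - y‖ := lt_of_le_of_ne (norm_nonneg _) (Ne.symm h)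
      nlinarith
    exact sub_eq_zero.1 (norm_eq_zero.1 h4)
  have hsub : T '' A ⊆ A + closedBall 0 t := by
    rintro _ ⟨x, hx, rfl⟩
    refine ⟨x, hx, t • φ x, ?_, rfl⟩
    rw [mem_closedBall_zero_iff, norm_smul, Real.norm_of_nonneg ht.le]
    nlinarith [hle x]
  refine le_trans ?_ (measure_mono hsub)
  rw [← lintegral_abs_det_fderiv_eq_addHaar_image volume hA
    (fun x _ => (hTd x).hasFDerivWithinAt) hinj.injOn]
  have h1 : IntegrableOn (fun _ : EuclideanSpace ℝ (Fin 2) => (1 : ℝ)) A := integrableOn_const hfin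
  have h2 : IntegrableOn (fun x => 1 + t * divergence φ x) A := h1.add (hidiv.const_mul t)
  have h3 : IntegrableOn (fun x => t ^ 2 * (fderiv ℝ φ x).det) A := hidet.const_mul _
  have h4 : IntegrableOn (fun x => 1 + t * divergence φ x + t ^ 2 * (fderiv ℝ φ x).det) A :=
    h2.add h3
  have hint : ∫ x in A, (1 + t * divergence φ x + t ^ 2 * (fderiv ℝ φ x).det) =
      volume.real A + t * (∫ x in A, divergence φ x) -
        (-∫ x in A, (fderiv ℝ φ x).det) * t ^ 2 := by
    rw [integral_add h2 h3, integral_add h1 (hidiv.const_mul t), integral_const_mul,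
      integral_const_mul]
    simp
    ring
  rw [← hint]
  calc ENNReal.ofReal (∫ x in A, (1 + t * divergence φ x + t ^ 2 * (fderiv ℝ φ x).det))
      ≤ ENNReal.ofReal (∫ x in A, |1 + t * divergence φ x + t ^ 2 * (fderiv ℝ φ x).det|) :=
        ENNReal.ofReal_le_ofReal (integral_mono h4 h4.abs fun x => le_abs_self _)
    _ = ∫⁻ x in A, ENNReal.ofReal |1 + t * divergence φ x + t ^ 2 * (fderiv ℝ φ x).det| :=
        ofReal_integral_eq_lintegral_ofReal h4.abs (ae_of_all _ fun x => abs_nonneg _)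
    _ = _ := by simp_rw [det_one_add_smul]; rfl

/-! ### The Brunn–Minkowski inequality in the plane -/

/-- The one-dimensional Brunn–Minkowski inequality for compact sets: `K + L` contains translates of
`K` and `L` that meet only at `sSup K + sInf L`. -/
lemma IsCompact.volume_add_le_volume_add {K L : Set ℝ} (hK : IsCompact K) (hL : IsCompact L)
    (hKn : K.Nonempty) (hLn : L.Nonempty) : volume K + volume L ≤ volume (K + L) := by
  set U := (fun x => x + sInf L) '' K with hU
  set V := (fun x => sSup K + x) '' L with hV
  have hUV : volume (U ∩ V) = 0 := by
    refine measure_mono_null (t := {sSup K + sInf L}) ?_ (by simp)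
    rintro _ ⟨⟨x, hx, rfl⟩, ⟨y, hy, hxy⟩⟩
    have h1 := le_csSup hK.bddAbove hx
    have h2 := csInf_le hL.bddBelow hy
    simp only [mem_singleton_iff] at hxy ⊢
    linarith
  have hVm : MeasurableSet V := (hL.image (by fun_prop)).measurableSet
  have h := measure_union_add_inter (μ := volume) U hVm
  rw [hUV, add_zero] at h
  have hKU : volume U = volume K := by simp [hU]
  have hLV : volume V = volume L := by simp [hV]
  rw [← hKU, ← hLV, ← h]
  refine measure_mono (union_subset ?_ ?_)
  · rintro _ ⟨x, hx, rfl⟩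
    exact add_mem_add hx (hL.sInf_mem hLn)
  · rintro _ ⟨x, hx, rfl⟩
    exact add_mem_add (hK.sSup_mem hKn) hx

/-- The one-dimensional Brunn–Minkowski inequality. -/
lemma MeasurableSet.volume_add_le_volume_add {A B : Set ℝ} (hA : MeasurableSet A)
    (hB : MeasurableSet B) (hAn : A.Nonempty) (hBn : B.Nonempty) :
    volume A + volume B ≤ volume (A + B) := by
  obtain ⟨a, ha⟩ := hAn
  obtain ⟨b, hb⟩ := hBn
  rw [hA.measure_eq_iSup_isCompact, hB.measure_eq_iSup_isCompact]
  simp only [iSup_and']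
  refine ENNReal.biSup_add_biSup_le' ⟨∅, empty_subset _, isCompact_empty⟩
    ⟨∅, empty_subset _, isCompact_empty⟩ fun K ⟨hK, hKc⟩ L ⟨hL, hLc⟩ => ?_
  calc volume K + volume L ≤ volume (insert a K) + volume (insert b L) := by
        gcongr <;> exact subset_insert _ _
    _ ≤ volume (insert a K + insert b L) :=
        (hKc.insert a).volume_add_le_volume_add (hLc.insert b) (insert_nonempty _ _)
          (insert_nonempty _ _)
    _ ≤ volume (A + B) :=
        measure_mono (add_subset_add (insert_subset ha hK) (insert_subset hb hL))

lemma lintegral_eq_lintegral_Ioo_meas_lt {f : ℝ → ℝ} (hf : Measurable f) (h0 : ∀ s, 0 ≤ f s)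
    (h1 : ∀ s, f s ≤ 1) :
    ∫⁻ s, ENNReal.ofReal (f s) = ∫⁻ c in Ioo (0 : ℝ) 1, volume {s | c < f s} := by
  rw [lintegral_eq_lintegral_meas_lt volume (ae_of_all _ h0) hf.aemeasurable,
    ← lintegral_indicator measurableSet_Ioi, ← lintegral_indicator measurableSet_Ioo]
  refine lintegral_congr fun c => ?_
  by_cases hc : c ∈ Ioo (0 : ℝ) 1
  · rw [indicator_of_mem hc, indicator_of_mem (show c ∈ Ioi (0 : ℝ) from hc.1)]
  · rw [indicator_of_notMem hc]
    refine indicator_apply_eq_zero.2 fun hc0 => ?_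
    have : {s | c < f s} = ∅ := by
      ext s
      simp only [mem_ofPred_eq, mem_empty_iff_false, iff_false, not_lt]
      exact (h1 s).trans (not_lt.1 fun h => hc ⟨hc0, h⟩)
    rw [this, measure_empty]

/-- A one-dimensional functional inequality of Prékopa–Leindler type: the superlevel sets of `h`,
rescaled by the sum of the suprema, contain the sums of the rescaled superlevel sets of `f` and
`g`. -/
lemma lintegral_div_add_lintegral_div_le {f g h : ℝ → ℝ} (hf : Measurable f) (hg : Measurable g)
    (hh : Measurable h) (hf0 : ∀ s, 0 ≤ f s) (hg0 : ∀ s, 0 ≤ g s) (hh0 : ∀ s, 0 ≤ h s)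
    (hfb : BddAbove (range f)) (hgb : BddAbove (range g))
    (hfp : 0 < ⨆ s, f s) (hgp : 0 < ⨆ s, g s)
    (H : ∀ s t, 0 < f s → 0 < g t → f s + g t ≤ h (s + t)) :
    (∫⁻ s, ENNReal.ofReal (f s / ⨆ s, f s)) + (∫⁻ s, ENNReal.ofReal (g s / ⨆ s, g s)) ≤
      ∫⁻ s, ENNReal.ofReal (h s / ((⨆ s, f s) + ⨆ s, g s)) := by
  set p := ⨆ s, f s
  set q := ⨆ s, g s
  rw [lintegral_eq_lintegral_Ioo_meas_lt (hf.div_const p) (fun s => div_nonneg (hf0 s) hfp.le)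
      (fun s => div_le_one_of_le₀ (le_ciSup hfb s) hfp.le),
    lintegral_eq_lintegral_Ioo_meas_lt (hg.div_const q) (fun s => div_nonneg (hg0 s) hgp.le)
      (fun s => div_le_one_of_le₀ (le_ciSup hgb s) hgp.le),
    lintegral_eq_lintegral_meas_lt volume
      (ae_of_all _ fun s => div_nonneg (hh0 s) (add_pos hfp hgp).le)
      (hh.div_const _).aemeasurable, ← lintegral_add_left]
  · refine le_trans (setLIntegral_mono' measurableSet_Ioo fun c hc => ?_)
      (lintegral_mono_set (Ioo_subset_Ioi_self))
    have hfn : {s | c < f s / p}.Nonempty := by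
      obtain ⟨s, hs⟩ := exists_lt_of_lt_ciSup (show c * p < p by nlinarith [hc.2])
      exact ⟨s, (lt_div_iff₀ hfp).2 hs⟩
    have hgn : {s | c < g s / q}.Nonempty := by
      obtain ⟨s, hs⟩ := exists_lt_of_lt_ciSup (show c * q < q by nlinarith [hc.2])
      exact ⟨s, (lt_div_iff₀ hgp).2 hs⟩
    refine (MeasurableSet.volume_add_le_volume_add
      (measurableSet_lt measurable_const (hf.div_const p))
      (measurableSet_lt measurable_const (hg.div_const q)) hfn hgn).trans (measure_mono ?_)
    rintro _ ⟨s, hs, t, ht, rfl⟩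
    simp only [mem_ofPred_eq] at hs ht ⊢
    rw [lt_div_iff₀ (by positivity)] at hs ht ⊢
    have h1 := mul_pos hc.1 hfp
    have h2 := mul_pos hc.1 hgp
    have := H s t (h1.trans hs) (h2.trans ht)
    linarith
  · exact Antitone.measurable fun a b hab => measure_mono fun s hs => lt_of_le_of_lt hab hs

lemma lintegral_volume_chord_div {A : Set (EuclideanSpace ℝ (Fin 2))}
    (hA : MeasurableSet A) (hb : Bornology.IsBounded A) {p : ℝ} (hp : 0 < p) :
    ∫⁻ s, ENNReal.ofReal (volume.real {t | chart 0 (s, t) ∈ A} / p) =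
      ENNReal.ofReal (volume.real A / p) := by
  have h1 : ∀ s, ENNReal.ofReal (volume.real {t | chart 0 (s, t) ∈ A} / p) =
      volume {t | chart 0 (s, t) ∈ A} / ENNReal.ofReal p := by
    intro s
    rw [ENNReal.ofReal_div_of_pos hp, Measure.real, ENNReal.ofReal_toReal (isBounded_chord 0 s hb).measure_lt_top.ne]
  simp_rw [h1, div_eq_mul_inv]
  rw [lintegral_mul_const _ (measurable_volume_chord 0 hA), ← volume_eq_lintegral_chord 0 hA,
    ← div_eq_mul_inv, ENNReal.ofReal_mul' (by positivity), ENNReal.ofReal_inv_of_pos hp,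
    Measure.real, ENNReal.ofReal_toReal hb.measure_lt_top.ne, div_eq_mul_inv]

lemma sq_sqrt_add_sqrt_le {a b p q : ℝ} (ha : 0 ≤ a) (hb : 0 ≤ b) (hp : 0 < p) (hq : 0 < q) :
    (√a + √b) ^ 2 ≤ (p + q) * (a / p + b / q) := by
  have h1 : (p + q) * (a / p + b / q) = a + b + (q * a / p + p * b / q) := by
    field_simp; ring
  have h2 : q * a / p + p * b / q - 2 * (√a * √b) = (q * √a - p * √b) ^ 2 / (p * q) := by
    have e1 : √a ^ 2 = a := Real.sq_sqrt ha
    have e2 : √b ^ 2 = b := Real.sq_sqrt hb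
    conv_lhs => rw [← e1, ← e2]
    rw [Real.sqrt_sq (Real.sqrt_nonneg a), Real.sqrt_sq (Real.sqrt_nonneg b)]
    field_simp
    ring
  have h3 : 0 ≤ (q * √a - p * √b) ^ 2 / (p * q) := by positivity
  nlinarith [Real.sq_sqrt ha, Real.sq_sqrt hb]

/-- The Brunn–Minkowski inequality for bounded planar sets, one of them open. -/
lemma sq_sqrt_volume_add_le {A B : Set (EuclideanSpace ℝ (Fin 2))} (hA : IsOpen A)
    (hB : MeasurableSet B) (hAb : Bornology.IsBounded A) (hBb : Bornology.IsBounded B)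
    (hA0 : 0 < volume.real A) (hB0 : 0 < volume.real B) :
    (√(volume.real A) + √(volume.real B)) ^ 2 ≤ volume.real (A + B) := by
  have hAB : IsOpen (A + B) := hA.add_right
  have hABb := hAb.add hBb
  -- chord lengths along the lines parallel to `dir 0`
  let f : Set (EuclideanSpace ℝ (Fin 2)) → ℝ → ℝ := fun D s => volume.real {t | chart 0 (s, t) ∈ D}
  have hm : ∀ D, MeasurableSet D → Measurable (f D) := fun D hD =>
    (measurable_volume_chord 0 hD).ennreal_toReal
  have hfin : ∀ D, Bornology.IsBounded D → ∀ s, volume {t | chart 0 (s, t) ∈ D} ≠ ∞ :=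
    fun D hD s => (isBounded_chord 0 s hD).measure_lt_top.ne
  have hbdd : ∀ D, Bornology.IsBounded D → BddAbove (range (f D)) := by
    intro D hD
    refine ⟨volume.real (axial 0 '' D), ?_⟩
    rintro _ ⟨s, rfl⟩
    refine measureReal_mono (fun t ht => ⟨_, ht, by simp⟩)
      ((axial 0).lipschitz.isBounded_image hD).measure_lt_top.ne
  have hpos : ∀ D, MeasurableSet D → Bornology.IsBounded D → 0 < volume.real D →
      0 < ⨆ s, f D s := by
    intro D hD hDb hD0
    by_contra hcon
    have hz : ∀ s, f D s = 0 := fun s =>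
      le_antisymm ((le_ciSup (hbdd D hDb) s).trans (not_lt.1 hcon)) measureReal_nonneg
    have := lintegral_volume_chord_div hD hDb one_pos
    simp only [f] at hz
    simp [hz] at this
    linarith
  have hp := hpos A hA.measurableSet hAb hA0
  have hq := hpos B hB hBb hB0
  have key := lintegral_div_add_lintegral_div_le (hm A hA.measurableSet) (hm B hB)
    (hm (A + B) hAB.measurableSet) (fun s => measureReal_nonneg) (fun s => measureReal_nonneg)
    (fun s => measureReal_nonneg) (hbdd A hAb) (hbdd B hBb) hp hq (by
      intro s s' hs hs'
      have hne : ∀ D r, 0 < f D r → {t | chart 0 (r, t) ∈ D}.Nonempty := by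
        intro D r hr
        by_contra h
        simp only [f] at hr
        simp [not_nonempty_iff_eq_empty.1 h] at hr
      have h1 := MeasurableSet.volume_add_le_volume_add
        (A := {t | chart 0 (s, t) ∈ A}) (B := {t | chart 0 (s', t) ∈ B})
        ((chart 0).measurable.comp measurable_prodMk_left hA.measurableSet)
        ((chart 0).measurable.comp measurable_prodMk_left hB) (hne _ _ hs) (hne _ _ hs')
      have h2 : {t | chart 0 (s, t) ∈ A} + {t | chart 0 (s', t) ∈ B} ⊆
          {t | chart 0 (s + s', t) ∈ A + B} := by
        rintro _ ⟨t, ht, t', ht', rfl⟩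
        refine ⟨_, ht, _, ht', ?_⟩
        ext i
        fin_cases i
        · simp [chart_apply]
        · simp [chart_apply]; ring
      have h3 := h1.trans (measure_mono h2)
      have h4 := ENNReal.toReal_mono (hfin _ hABb _) h3
      rwa [ENNReal.toReal_add (hfin _ hAb _) (hfin _ hBb _)] at h4)
  simp only [f] at key hp hq
  rw [lintegral_volume_chord_div hA.measurableSet hAb hp,
    lintegral_volume_chord_div hB hBb hq,
    lintegral_volume_chord_div hAB.measurableSet hABb (add_pos hp hq),
    ← ENNReal.ofReal_add (by positivity) (by positivity),
    ENNReal.ofReal_le_ofReal_iff (by positivity), le_div_iff₀ (by positivity)] at key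
  refine (sq_sqrt_add_sqrt_le hA0.le hB0.le hp hq).trans ?_
  linarith

/-! ### Approximating the disc by zonotopes -/

lemma integral_abs_cos_sub (β : ℝ) : ∫ t in (0 : ℝ)..Real.pi, |Real.cos (β - t)| = 2 := by
  have hp : Function.Periodic (fun t => |Real.cos t|) Real.pi := fun t => by
    simp [Real.cos_add_pi]
  rw [intervalIntegral.integral_comp_sub_left (fun t => |Real.cos t|) β]
  have h := hp.intervalIntegral_add_eq (β - Real.pi) (-(Real.pi / 2))
  rw [sub_zero]
  rw [sub_add_cancel, show -(Real.pi / 2) + Real.pi = Real.pi / 2 by ring] at h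
  rw [h]
  have : ∫ t in -(Real.pi / 2)..(Real.pi / 2), |Real.cos t| =
      ∫ t in -(Real.pi / 2)..(Real.pi / 2), Real.cos t := by
    refine intervalIntegral.integral_congr fun t ht => ?_
    rw [uIcc_of_le (by linarith [Real.pi_pos])] at ht
    exact abs_of_nonneg (Real.cos_nonneg_of_mem_Icc ht)
  rw [this, integral_cos]
  simp
  norm_num

/-- The Riemann sum of `∫₀^π |cos (β - t)| dt = 2` over `n` equal intervals. -/
lemma abs_sum_abs_cos_sub_two_le (β : ℝ) {n : ℕ} (hn : 0 < n) :
    |Real.pi / n * ∑ i ∈ Finset.range n, |Real.cos (β - i * (Real.pi / n))| - 2| ≤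
      Real.pi ^ 2 / n := by
  set h := Real.pi / n with hh
  have hnR : (0 : ℝ) < n := Nat.cast_pos.2 hn
  have hpos : 0 < h := div_pos Real.pi_pos hnR
  have hcont : Continuous fun t => |Real.cos (β - t)| := by fun_prop
  have hsum : ∑ i ∈ Finset.range n, ∫ t in (i * h)..((i + 1 : ℕ) * h), |Real.cos (β - t)| = 2 := by
    rw [intervalIntegral.sum_integral_adjacent_intervals (a := fun i : ℕ => (i : ℝ) * h)
      fun k _ => hcont.intervalIntegrable _ _]
    rw [Nat.cast_zero, zero_mul, hh, mul_div_cancel₀ _ hnR.ne', integral_abs_cos_sub]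
  have hterm : ∀ i ∈ Finset.range n, |h * |Real.cos (β - i * h)| -
      (∫ t in (i * h)..((i + 1 : ℕ) * h), |Real.cos (β - t)|)| ≤ h * h := by
    intro i _
    have hlen : ((i + 1 : ℕ) : ℝ) * h - i * h = h := by push_cast; ring
    have e : h * |Real.cos (β - i * h)| =
        ∫ t in (i * h)..((i + 1 : ℕ) * h), |Real.cos (β - i * h)| := by
      rw [intervalIntegral.integral_const, hlen, smul_eq_mul]
    rw [e, ← intervalIntegral.integral_sub (by simp) (hcont.intervalIntegrable _ _)]
    refine (intervalIntegral.norm_integral_le_of_norm_le_const (C := h)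
      (f := fun t => |Real.cos (β - i * h)| - |Real.cos (β - t)|) fun t ht => ?_).trans ?_
    · rw [uIoc_of_le (by push_cast; nlinarith)] at ht
      rw [Real.norm_eq_abs]
      refine (abs_abs_sub_abs_le_abs_sub _ _).trans ?_
      have h1 := Real.abs_cos_sub_cos_le (β - i * h) (β - t)
      refine h1.trans ?_
      have : β - i * h - (β - t) = t - i * h := by ring
      rw [this, abs_of_nonneg (by linarith [ht.1])]
      linarith [ht.2]
    · rw [hlen, abs_of_pos hpos]
  calc |h * ∑ i ∈ Finset.range n, |Real.cos (β - i * h)| - 2|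
      = |∑ i ∈ Finset.range n, (h * |Real.cos (β - i * h)| -
          ∫ t in (i * h)..((i + 1 : ℕ) * h), |Real.cos (β - t)|)| := by
        rw [Finset.sum_sub_distrib, hsum, Finset.mul_sum]
    _ ≤ ∑ i ∈ Finset.range n, h * h :=
        (Finset.abs_sum_le_sum_abs _ _).trans (Finset.sum_le_sum hterm)
    _ = Real.pi ^ 2 / n := by
        rw [Finset.sum_const, Finset.card_range, nsmul_eq_mul, hh]
        field_simp

lemma exists_eq_norm_smul_dir (v : EuclideanSpace ℝ (Fin 2)) : ∃ β, v = ‖v‖ • dir β := by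
  set z : ℂ := ⟨v 0, v 1⟩ with hz
  have hn : ‖z‖ = ‖v‖ := by
    rw [EuclideanSpace.norm_eq, Fin.sum_univ_two, Complex.norm_def, Complex.normSq_apply]
    simp [hz, sq]
  refine ⟨z.arg, ?_⟩
  ext i
  fin_cases i <;> simp [dir, ← hn, hz]

lemma axial_dir_eq_cos (α β : ℝ) : axial α (dir β) = Real.cos (β - α) := by
  rw [axial_apply, Real.cos_sub]; simp [dir]; ring

/-- Up to a factor close to `1`, the Euclidean norm is an average of the seminorms `|⟨u, ·⟩|` over
finitely many equidistributed unit vectors `u`. -/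
lemma exists_directions {δ : ℝ} (hδ : 0 < δ) : ∃ (n : ℕ) (α : ℕ → ℝ) (c : ℝ), 0 < c ∧
    ∀ v : EuclideanSpace ℝ (Fin 2),
      (1 - δ) * ‖v‖ ≤ c * ∑ i ∈ Finset.range n, |axial (α i) v| ∧
      c * ∑ i ∈ Finset.range n, |axial (α i) v| ≤ ‖v‖ := by
  obtain ⟨n, hn⟩ := exists_nat_gt (Real.pi ^ 2 / δ)
  have hnR : (0 : ℝ) < n := lt_trans (by positivity) hn
  set x := Real.pi ^ 2 / n with hx
  have hx0 : 0 < x := by positivity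
  have hxδ : x ≤ δ := by
    rw [hx, div_le_iff₀ hnR]; rw [div_lt_iff₀ hδ] at hn; linarith
  -- `π / n ∑ |cos|` lies in `[2 - x, 2 + x]`, so dividing by `2 + x` makes the upper bound exact and
  -- costs at most the factor `(2 - x) / (2 + x) ≥ 1 - x` in the lower one
  refine ⟨n, fun i => i * (Real.pi / n), Real.pi / n / (2 + x), by positivity, fun v => ?_⟩
  obtain ⟨β, hβ⟩ := exists_eq_norm_smul_dir v
  have hS : ∑ i ∈ Finset.range n, |axial (i * (Real.pi / n)) v| =
      ‖v‖ * ∑ i ∈ Finset.range n, |Real.cos (β - i * (Real.pi / n))| := by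
    rw [Finset.mul_sum]
    refine Finset.sum_congr rfl fun i _ => ?_
    conv_lhs => rw [hβ]
    rw [map_smul, smul_eq_mul, abs_mul, abs_norm, axial_dir_eq_cos]
  have hR := abs_le.1 (abs_sum_abs_cos_sub_two_le β (Nat.cast_pos.1 hnR))
  rw [← hx] at hR
  set S := ∑ i ∈ Finset.range n, |Real.cos (β - i * (Real.pi / n))|
  have e : Real.pi / n / (2 + x) * (‖v‖ * S) = ‖v‖ * (Real.pi / n * S / (2 + x)) := by ring
  rw [hS, e]
  constructor
  · rw [mul_comm]
    refine mul_le_mul_of_nonneg_left ?_ (norm_nonneg v)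
    rw [le_div_iff₀ (by positivity)]
    nlinarith
  · refine mul_le_of_le_one_right (norm_nonneg v) ?_
    rw [div_le_one (by positivity)]
    linarith

/-- A disc is contained in a zonotope as soon as its support function is the smaller one. -/
lemma closedBall_subset_zonotope {ι : Type*} (α : ι → ℝ) (s : Finset ι) {r R : ℝ}
    (hR : 0 ≤ R) (h : ∀ v, r * ‖v‖ ≤ R * ∑ i ∈ s, |axial (α i) v|) :
    closedBall 0 r ⊆ zonotope α s R := by
  intro x hx
  by_contra hxZ
  obtain ⟨f, u, hfZ, hfx⟩ := geometric_hahn_banach_closed_point (convex_zonotope α s R)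
    (isCompact_zonotope α s R).isClosed hxZ
  -- a separating functional `⟨v, ·⟩`
  set v := (InnerProductSpace.toDual ℝ (EuclideanSpace ℝ (Fin 2))).symm f with hv
  have hf : ∀ y, f y = inner ℝ v y := fun y => by
    rw [hv, InnerProductSpace.toDual_symm_apply]
  have hsgn : ∀ i, SignType.sign (axial (α i) v) * axial (α i) v = |axial (α i) v| :=
    fun i => sign_mul_self _
  -- the vertex of the zonotope that maximises `⟨v, ·⟩`
  have hz : ∑ i ∈ s, (R * (SignType.sign (axial (α i) v) : ℝ)) • dir (α i) ∈ zonotope α s R := by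
    refine Set.finsetSum_mem_finsetSum _ _ _ fun i _ => ⟨_, ?_, rfl⟩
    rcases lt_trichotomy (axial (α i) v) 0 with h0 | h0 | h0 <;> simp [h0, hR]
  have h1 := hfZ _ hz
  rw [map_sum] at h1
  have h2 : ∑ i ∈ s, f ((R * (SignType.sign (axial (α i) v) : ℝ)) • dir (α i)) =
      R * ∑ i ∈ s, |axial (α i) v| := by
    rw [Finset.mul_sum]
    refine Finset.sum_congr rfl fun i _ => ?_
    rw [map_smul, hf, real_inner_comm, ← axial_eq_inner, smul_eq_mul, mul_assoc, hsgn]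
  have h3 : f x ≤ r * ‖v‖ := by
    rw [hf]
    refine (real_inner_le_norm v x).trans ?_
    rw [mul_comm]
    gcongr
    exact mem_closedBall_zero_iff.1 hx
  linarith [h v]

/-! ### Lower bound for the perimeter by shadows -/

section

open scoped Manifold ContDiff

/-- A smooth step: it vanishes left of `t₀ - r / 2` and equals one right of `t₀ + r / 2`. -/
def smoothStep (t₀ r t : ℝ) : ℝ := Real.smoothTransition ((t - t₀) / r + 1 / 2)

lemma contDiff_smoothStep (t₀ r : ℝ) : ContDiff ℝ ∞ (smoothStep t₀ r) :=
  Real.smoothTransition.contDiff.comp (by fun_prop)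

lemma smoothStep_mem_Icc (t₀ r t : ℝ) : smoothStep t₀ r t ∈ Icc (0 : ℝ) 1 :=
  ⟨Real.smoothTransition.nonneg _, Real.smoothTransition.le_one _⟩

lemma smoothStep_eq_zero {t₀ r t : ℝ} (hr : 0 < r) (h : t ≤ t₀ - r / 2) :
    smoothStep t₀ r t = 0 := by
  refine Real.smoothTransition.zero_of_nonpos ?_
  have : (t - t₀) / r ≤ -(1 / 2) := by rw [div_le_iff₀ hr]; linarith
  linarith

lemma smoothStep_eq_one {t₀ r t : ℝ} (hr : 0 < r) (h : t₀ + r / 2 ≤ t) :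
    smoothStep t₀ r t = 1 := by
  refine Real.smoothTransition.one_of_one_le ?_
  have : 1 / 2 ≤ (t - t₀) / r := by rw [le_div_iff₀ hr]; linarith
  linarith

lemma support_deriv_smoothStep_subset {t₀ r : ℝ} (hr : 0 < r) :
    Function.support (deriv (smoothStep t₀ r)) ⊆ Icc (t₀ - r / 2) (t₀ + r / 2) := by
  intro t ht
  by_contra hcon
  refine ht ?_
  rcases lt_or_ge t (t₀ - r / 2) with h | h
  · have : smoothStep t₀ r =ᶠ[nhds t] fun _ => 0 := by
      filter_upwards [Iio_mem_nhds h] with y hy using smoothStep_eq_zero hr (le_of_lt hy)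
    rw [this.deriv_eq]; simp
  · have h' : t₀ + r / 2 < t := not_le.1 fun h2 => hcon ⟨h, h2⟩
    have : smoothStep t₀ r =ᶠ[nhds t] fun _ => 1 := by
      filter_upwards [Ioi_mem_nhds h'] with y hy using smoothStep_eq_one hr (le_of_lt hy)
    rw [this.deriv_eq]; simp

lemma continuous_deriv_smoothStep (t₀ r : ℝ) : Continuous (deriv (smoothStep t₀ r)) :=
  (contDiff_smoothStep t₀ r).continuous_deriv (by simp)

lemma integrable_deriv_smoothStep {t₀ r : ℝ} (hr : 0 < r) :
    Integrable (deriv (smoothStep t₀ r)) :=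
  (continuous_deriv_smoothStep t₀ r).integrable_of_hasCompactSupport
    (HasCompactSupport.of_support_subset_isCompact isCompact_Icc
      (support_deriv_smoothStep_subset hr))

lemma integral_deriv_smoothStep {t₀ r : ℝ} (hr : 0 < r) :
    ∫ t, deriv (smoothStep t₀ r) t = 1 := by
  have h := integral_of_hasDerivAt_of_tendsto (m := 0) (n := 1)
    (fun t => (((contDiff_smoothStep t₀ r).differentiable (by simp)) t).hasDerivAt)
    (integrable_deriv_smoothStep hr) ?_ ?_
  · simpa using h
  · refine tendsto_const_nhds.congr' ?_
    filter_upwards [Filter.eventually_le_atBot (t₀ - r / 2)] with t ht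
      using (smoothStep_eq_zero hr ht).symm
  · refine tendsto_const_nhds.congr' ?_
    filter_upwards [Filter.eventually_ge_atTop (t₀ + r / 2)] with t ht
      using (smoothStep_eq_one hr ht).symm

/-- A finite smooth partition of unity on a compact set of the line, subordinate to intervals of
prescribed radii. -/
lemma exists_finite_partition_of_unity {K : Set ℝ} (hK : IsCompact K) (r : ℝ → ℝ)
    (hr : ∀ s ∈ K, 0 < r s) : ∃ (F : Finset ℝ) (χ : F → ℝ → ℝ), (∀ j : F, (j : ℝ) ∈ K) ∧
      (∀ j, ContDiff ℝ ∞ (χ j)) ∧ (∀ j s, 0 ≤ χ j s) ∧ (∀ s, ∑ j, χ j s ≤ 1) ∧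
      (∀ s ∈ K, ∑ j, χ j s = 1) ∧ ∀ j : F, Function.support (χ j) ⊆ ball (j : ℝ) (r j) := by
  obtain ⟨F, hFK, hF⟩ := hK.elim_nhds_subcover (fun s => ball s (r s))
    fun s hs => ball_mem_nhds s (hr s hs)
  obtain ⟨f, hf⟩ := SmoothPartitionOfUnity.exists_isSubordinate 𝓘(ℝ) hK.isClosed
    (fun j : F => ball (j : ℝ) (r j)) (fun j => isOpen_ball) (by
      intro x hx
      obtain ⟨s, hs, hxs⟩ := mem_iUnion₂.1 (hF hx)
      exact mem_iUnion.2 ⟨⟨s, hs⟩, hxs⟩)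
  refine ⟨F, fun j => f j, fun j => hFK j j.2, fun j => (f j).contMDiff.contDiff,
    fun j s => f.nonneg j s, fun s => ?_, fun s hs => ?_, fun j => ?_⟩
  · simpa [finsum_eq_sum_of_fintype] using f.sum_le_one s
  · simpa [finsum_eq_sum_of_fintype] using f.sum_eq_one hs
  · exact (subset_tsupport _).trans (hf j)

/-- For an open set `A` and a direction `u`, the supremum of `∫_A ∂_u g` over admissible scalar
test functions `g` is at least twice the length of the shadow of `A`: along each line meeting `A`
let `g` increase from `-1` to `1` inside `A`. -/
lemma exists_test_function (α : ℝ) {A : Set (EuclideanSpace ℝ (Fin 2))} (hA : IsOpen A)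
    (hb : Bornology.IsBounded A) {η : ℝ} (hη : 0 < η) :
    ∃ g : EuclideanSpace ℝ (Fin 2) → ℝ, ContDiff ℝ 1 g ∧ HasCompactSupport g ∧ (∀ x, |g x| ≤ 1) ∧
      2 * volume.real (shadow α A) - η ≤ ∫ x in A, fderiv ℝ g x (dir α) := by
  have hfin := volume_shadow_ne_top α hb
  obtain ⟨K, hKA, hKc, hK⟩ := (isOpen_shadow α hA).measurableSet.exists_isCompact_lt_add hfin
    (ε := ENNReal.ofReal (η / 2)) (by simpa using hη)
  have hKr : volume.real (shadow α A) ≤ volume.real K + η / 2 := by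
    have h := ENNReal.toReal_mono
      (ENNReal.add_ne_top.2 ⟨hKc.measure_lt_top.ne, ENNReal.ofReal_ne_top⟩) hK.le
    rwa [ENNReal.toReal_add hKc.measure_lt_top.ne ENNReal.ofReal_ne_top,
      ENNReal.toReal_ofReal (by positivity)] at h
  -- squares inside `A` centred on the lines over `K`
  have hex : ∀ s, ∃ t r : ℝ, s ∈ K → 0 < r ∧ ball (s, t) r ⊆ chart α ⁻¹' A := by
    intro s
    by_cases hs : s ∈ K
    · obtain ⟨t, ht⟩ := mem_shadow_iff.1 (hKA hs)
      obtain ⟨r, hr, hrs⟩ := Metric.isOpen_iff.1 (hA.preimage (continuous_chart α)) (s, t) ht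
      exact ⟨t, r, fun _ => ⟨hr, hrs⟩⟩
    · exact ⟨0, 0, fun h => absurd h hs⟩
  choose T r hTr using hex
  obtain ⟨F, χ, hFK, hχs, hχ0, hχ1, hχK, hχsupp⟩ :=
    exists_finite_partition_of_unity hKc r fun s hs => (hTr s hs).1
  have hr : ∀ j : F, 0 < r j := fun j => (hTr j (hFK j)).1
  obtain ⟨R, hR, hAR⟩ := hb.subset_ball_lt 0 0
  -- `κ` cuts off outside `A`; `G` is the increasing profile along each line over `K`
  let κ : ContDiffBump (0 : EuclideanSpace ℝ (Fin 2)) := ⟨R, R + 1, hR, by linarith⟩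
  let G : EuclideanSpace ℝ (Fin 2) → ℝ := fun x =>
    2 * ∑ j, χ j (transverse α x) * smoothStep (T j) (r j) (axial α x) - 1
  have hGs : ContDiff ℝ ∞ G := by
    refine ContDiff.sub (contDiff_const.mul (ContDiff.sum fun j _ => ?_)) contDiff_const
    exact ((hχs j).comp (transverse α).contDiff).mul
      ((contDiff_smoothStep _ _).comp (axial α).contDiff)
  have hG1 : ∀ x, |G x| ≤ 1 := by
    intro x
    have h0 : 0 ≤ ∑ j, χ j (transverse α x) * smoothStep (T j) (r j) (axial α x) :=
      Finset.sum_nonneg fun j _ => mul_nonneg (hχ0 j _) (smoothStep_mem_Icc _ _ _).1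
    have h1 : ∑ j, χ j (transverse α x) * smoothStep (T j) (r j) (axial α x) ≤ 1 :=
      (Finset.sum_le_sum fun j _ =>
        mul_le_of_le_one_right (hχ0 j _) (smoothStep_mem_Icc _ _ _).2).trans (hχ1 _)
    exact abs_le.2 ⟨by simp only [G]; linarith, by simp only [G]; linarith⟩
  have hGd : ∀ x, fderiv ℝ G x (dir α) =
      2 * ∑ j, χ j (transverse α x) * deriv (smoothStep (T j) (r j)) (axial α x) := by
    intro x
    have h : ∀ j, HasFDerivAt
        (fun x => χ j (transverse α x) * smoothStep (T j) (r j) (axial α x))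
        (χ j (transverse α x) • (deriv (smoothStep (T j) (r j)) (axial α x) • axial α) +
          smoothStep (T j) (r j) (axial α x) • (deriv (χ j) (transverse α x) • transverse α)) x :=
      fun j => (((hχs j).differentiable (by simp) _).hasDerivAt.comp_hasFDerivAt x
          (transverse α).hasFDerivAt).mul
        ((((contDiff_smoothStep _ _).differentiable (by simp)) _).hasDerivAt.comp_hasFDerivAt x
          (axial α).hasFDerivAt)
    have h2 := ((HasFDerivAt.fun_sum fun j (_ : j ∈ Finset.univ) => h j).const_mul 2).sub_const 1
    rw [h2.fderiv]
    simp
  refine ⟨fun x => G x * κ x, (hGs.mul κ.contDiff).of_le (by simp),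
    κ.hasCompactSupport.mul_left, fun x => ?_, ?_⟩
  · rw [abs_mul, abs_of_nonneg κ.nonneg]
    exact mul_le_one₀ (hG1 x) κ.nonneg κ.le_one
  have hcut : ∀ x ∈ A, fderiv ℝ (fun x => G x * κ x) x (dir α) =
      2 * ∑ j, χ j (transverse α x) * deriv (smoothStep (T j) (r j)) (axial α x) := by
    intro x hx
    have : (fun x => G x * κ x) =ᶠ[nhds x] G := by
      filter_upwards [isOpen_ball.mem_nhds (hAR hx)] with y hy
      rw [κ.one_of_mem_closedBall (ball_subset_closedBall hy), mul_one]
    rw [this.fderiv_eq, hGd]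
  rw [setIntegral_congr_fun hA.measurableSet hcut]
  have hχi : ∀ j, Integrable (χ j) := fun j =>
    (hχs j).continuous.integrable_of_hasCompactSupport
      (HasCompactSupport.of_support_subset_isCompact (isCompact_closedBall (j : ℝ) (r j))
        ((hχsupp j).trans ball_subset_closedBall))
  have hprod : ∀ j, Integrable fun p : ℝ × ℝ =>
      χ j p.1 * deriv (smoothStep (T j) (r j)) p.2 := fun j =>
    (hχi j).mul_prod (integrable_deriv_smoothStep (hr j))
  have hmp := measurePreserving_chart α
  have hsymm : ∀ x, (chart α).symm x = (transverse α x, axial α x) := fun x => by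
    rw [MeasurableEquiv.symm_apply_eq, chart_transverse_axial]
  have hplane : ∀ j, Integrable fun x =>
      χ j (transverse α x) * deriv (smoothStep (T j) (r j)) (axial α x) := fun j => by
    have := ((hmp.symm _).integrable_comp_emb (chart α).symm.measurableEmbedding).2 (hprod j)
    simpa [Function.comp_def, hsymm] using this
  -- each product is supported in one of the squares inside `A`, so it may be integrated over the
  -- whole plane
  have hval : ∀ j, ∫ x in A, χ j (transverse α x) * deriv (smoothStep (T j) (r j)) (axial α x) =
      ∫ s, χ j s := by
    intro j
    rw [setIntegral_eq_integral_of_forall_compl_eq_zero]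
    · have := (hmp.symm _).integral_comp (chart α).symm.measurableEmbedding
        (fun p : ℝ × ℝ => χ j p.1 * deriv (smoothStep (T j) (r j)) p.2)
      simp only [hsymm] at this
      rw [this, Measure.volume_eq_prod, integral_prod_mul, integral_deriv_smoothStep (hr j),
        mul_one]
    · intro x hx
      by_contra hne
      refine hx ?_
      have h1 := hχsupp j (left_ne_zero_of_mul hne)
      have h2 := support_deriv_smoothStep_subset (hr j) (right_ne_zero_of_mul hne)
      have h3 : (transverse α x, axial α x) ∈ ball ((j : ℝ), T j) (r j) := by
        rw [← ball_prod_same]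
        refine ⟨h1, ?_⟩
        rw [mem_ball, Real.dist_eq, abs_lt]
        have := hr j
        exact ⟨by linarith [h2.1], by linarith [h2.2]⟩
      simpa using (hTr j (hFK j)).2 h3
  rw [integral_const_mul, integral_finsetSum _ fun j _ => (hplane j).integrableOn]
  simp_rw [hval]
  rw [← integral_finsetSum _ fun j _ => hχi j]
  have hlow : volume.real K ≤ ∫ s, ∑ j, χ j s := by
    have h1 : ∫ s in K, (1 : ℝ) = volume.real K := by simp
    rw [← h1, setIntegral_congr_fun hKc.measurableSet fun s hs => (hχK s hs).symm]
    exact setIntegral_le_integral (integrable_finsetSum _ fun j _ => hχi j)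
      (ae_of_all _ fun s => Finset.sum_nonneg fun j _ => hχ0 j s)
  linarith

end

/-- If `c ∑ |⟨u, ·⟩| ≤ ‖·‖` for finitely many unit vectors `u`, the correspondingly weighted shadows
of an open set bound its perimeter from below. Scalar test functions `g_u` are assembled into the
field `c ∑ g_u u`, whose norm is at most one by duality. -/
lemma ofReal_mul_sum_volume_shadow_le_perimeter {ι : Type*} (α : ι → ℝ) (s : Finset ι) {c : ℝ}
    (hc : 0 ≤ c) (h : ∀ v, c * ∑ i ∈ s, |axial (α i) v| ≤ ‖v‖)
    {A : Set (EuclideanSpace ℝ (Fin 2))} (hA : IsOpen A) (hb : Bornology.IsBounded A) :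
    ENNReal.ofReal (2 * c * ∑ i ∈ s, volume.real (shadow (α i) A)) ≤ perimeter A := by
  refine ENNReal.le_of_forall_pos_le_add fun ε hε _ => ?_
  set η : ℝ := ε / (c * s.card + 1) with hη
  have hD : 0 < c * s.card + 1 := by positivity
  have hη0 : 0 < η := div_pos hε hD
  choose g hgs hgc hg1 hgi using fun i => exists_test_function (α i) hA hb hη0
  set φ : EuclideanSpace ℝ (Fin 2) → EuclideanSpace ℝ (Fin 2) :=
    fun x => ∑ i ∈ s, (c * g i x) • dir (α i) with hφ
  have hφs : ContDiff ℝ 1 φ :=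
    ContDiff.sum fun i _ => (contDiff_const.mul (hgs i)).smul contDiff_const
  have hφc : HasCompactSupport φ := by
    refine HasCompactSupport.of_support_subset_isCompact
      (s.isCompact_biUnion fun i _ => hgc i) fun x hx => ?_
    obtain ⟨i, hi, hne⟩ := Finset.exists_ne_zero_of_sum_ne_zero hx
    refine mem_iUnion₂.2 ⟨i, hi, subset_tsupport _ ?_⟩
    exact right_ne_zero_of_mul (smul_ne_zero_iff.1 hne).1
  -- testing `φ x` against itself: `‖φ‖² = c ∑ g ⟨u, φ⟩ ≤ c ∑ |⟨u, φ⟩| ≤ ‖φ‖`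
  have hφ1 : ∀ x, ‖φ x‖ ≤ 1 := by
    intro x
    have h1 : ‖φ x‖ ^ 2 ≤ ‖φ x‖ := by
      calc ‖φ x‖ ^ 2 = inner ℝ (∑ i ∈ s, (c * g i x) • dir (α i)) (φ x) := by
            rw [← real_inner_self_eq_norm_sq]
        _ = ∑ i ∈ s, c * (g i x * axial (α i) (φ x)) := by
            rw [sum_inner]
            refine Finset.sum_congr rfl fun i _ => ?_
            rw [real_inner_smul_left, axial_eq_inner, mul_assoc]
        _ ≤ ∑ i ∈ s, c * |axial (α i) (φ x)| := by
            refine Finset.sum_le_sum fun i _ => mul_le_mul_of_nonneg_left ?_ hc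
            refine (le_abs_self _).trans ?_
            rw [abs_mul]
            exact mul_le_of_le_one_left (abs_nonneg _) (hg1 i x)
        _ ≤ ‖φ x‖ := by rw [← Finset.mul_sum]; exact h _
    by_contra hcon
    nlinarith
  have hdiv : ∀ x, divergence φ x = ∑ i ∈ s, c * fderiv ℝ (g i) x (dir (α i)) := by
    intro x
    have hd : HasFDerivAt φ (∑ i ∈ s, (c • fderiv ℝ (g i) x).smulRight (dir (α i))) x :=
      HasFDerivAt.fun_sum fun i _ =>
        ((((hgs i).differentiable one_ne_zero) x).hasFDerivAt.const_mul c).smul_const _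
    have hdir : ∀ i, dir (α i) = Real.cos (α i) • EuclideanSpace.single 0 1 +
        Real.sin (α i) • EuclideanSpace.single 1 1 := by
      intro i; ext k; fin_cases k <;> simp [dir]
    rw [divergence, hd.fderiv, Fin.sum_univ_two]
    simp only [FunLike.coe_sum, Finset.sum_apply, WithLp.ofLp_sum]
    rw [← Finset.sum_add_distrib]
    refine Finset.sum_congr rfl fun i _ => ?_
    conv_rhs => rw [hdir i, map_add, map_smul, map_smul]
    simp [dir]
    ring
  have hgint : ∀ i, Integrable (fun x => fderiv ℝ (g i) x (dir (α i))) := fun i =>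
    (((hgs i).continuous_fderiv one_ne_zero).clm_apply
      continuous_const).integrable_of_hasCompactSupport
      (((hgc i).fderiv ℝ).comp_left (g := fun L : EuclideanSpace ℝ (Fin 2) →L[ℝ] ℝ =>
        L (dir (α i))) rfl)
  have hlow : 2 * c * ∑ i ∈ s, volume.real (shadow (α i) A) - ε ≤ ∫ x in A, divergence φ x := by
    simp_rw [hdiv]
    rw [integral_finsetSum _ fun i _ => ((hgint i).const_mul c).integrableOn]
    simp_rw [integral_const_mul]
    have h1 : ∑ i ∈ s, c * (2 * volume.real (shadow (α i) A) - η) ≤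
        ∑ i ∈ s, c * ∫ x in A, fderiv ℝ (g i) x (dir (α i)) :=
      Finset.sum_le_sum fun i _ => mul_le_mul_of_nonneg_left (hgi i) hc
    have h2 : ∑ i ∈ s, c * (2 * volume.real (shadow (α i) A) - η) =
        2 * c * ∑ i ∈ s, volume.real (shadow (α i) A) - c * s.card * η := by
      rw [← Finset.mul_sum, Finset.sum_sub_distrib, ← Finset.mul_sum, Finset.sum_const,
        nsmul_eq_mul]
      ring
    have h3 : c * s.card * η ≤ ε := by
      rw [hη, mul_div_assoc', div_le_iff₀ hD]
      nlinarith [ε.coe_nonneg]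
    linarith
  have hP : ENNReal.ofReal (∫ x in A, divergence φ x) ≤ perimeter A :=
    le_iSup_of_le φ (le_iSup_of_le hφs (le_iSup_of_le hφc (le_iSup_of_le hφ1 le_rfl)))
  calc _ ≤ ENNReal.ofReal ((∫ x in A, divergence φ x) + ε) :=
        ENNReal.ofReal_le_ofReal (by linarith)
    _ ≤ ENNReal.ofReal (∫ x in A, divergence φ x) + ENNReal.ofReal ε := ENNReal.ofReal_add_le
    _ ≤ perimeter A + ε := by
        rw [ENNReal.ofReal_coe_nnreal]; gcongr

/-! ### Perimeter of the convex hull -/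

lemma le_of_forall_mul_le_mul_add_sq {a b K t₀ : ℝ} (ht₀ : 0 < t₀)
    (h : ∀ t, 0 < t → t < t₀ → a * t ≤ b * t + K * t ^ 2) : a ≤ b := by
  have hlim : Filter.Tendsto (fun t => b + K * t) (nhdsWithin 0 (Ioi 0)) (nhds b) := by
    have : Filter.Tendsto (fun t => b + K * t) (nhds 0) (nhds (b + K * 0)) :=
      (by fun_prop : Continuous fun t => b + K * t).tendsto 0
    simpa using this.mono_left nhdsWithin_le_nhds
  refine ge_of_tendsto hlim ?_
  filter_upwards [Ioo_mem_nhdsGT ht₀] with t ht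
  refine le_of_mul_le_mul_right ?_ ht.1
  linarith [h t ht.1 ht.2]

/-- For convex `C`, the area of the `t`-neighbourhood grows at most at the rate prescribed by the
shadows, up to the factor comparing the disc with the zonotope. -/
lemma exists_volume_add_closedBall_le {ι : Type*} (α : ι → ℝ) (s : Finset ι) {c δ : ℝ}
    (hc : 0 ≤ c) (hδ : δ < 1) (h : ∀ v, (1 - δ) * ‖v‖ ≤ c * ∑ i ∈ s, |axial (α i) v|)
    {C : Set (EuclideanSpace ℝ (Fin 2))} (hC : IsOpen C) (hconv : Convex ℝ C)
    (hb : Bornology.IsBounded C) (hne : C.Nonempty) : ∃ K : ℝ, ∀ t, 0 < t →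
      volume.real (C + closedBall 0 t) ≤ volume.real C +
        (2 * c * ∑ i ∈ s, volume.real (shadow (α i) C)) / (1 - δ) * t + K * t ^ 2 := by
  have hδ' : 0 < 1 - δ := by linarith
  refine ⟨4 * (c / (1 - δ)) ^ 2 * s.card ^ 2, fun t ht => ?_⟩
  set R := c / (1 - δ) * t with hR
  have hR0 : 0 ≤ R := by positivity
  have hball : closedBall 0 t ⊆ zonotope α s R := by
    refine closedBall_subset_zonotope α s hR0 fun v => ?_
    have h1 : ‖v‖ ≤ c / (1 - δ) * ∑ i ∈ s, |axial (α i) v| := by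
      rw [div_mul_eq_mul_div, le_div_iff₀ hδ', mul_comm]; exact h v
    calc t * ‖v‖ ≤ t * (c / (1 - δ) * ∑ i ∈ s, |axial (α i) v|) := by gcongr
      _ = _ := by rw [hR]; ring
  have h1 := (measure_mono (add_subset_add_left hball)).trans
    (volume_add_zonotope_le α s hR0 hC hconv hb hne)
  have hsh : ∀ i ∈ s, volume (shadow (α i) C) ≠ ∞ := fun i _ => volume_shadow_ne_top _ hb
  have hsum : ∑ i ∈ s, volume (shadow (α i) C) =
      ENNReal.ofReal (∑ i ∈ s, volume.real (shadow (α i) C)) := by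
    rw [ENNReal.ofReal_sum_of_nonneg fun i _ => measureReal_nonneg]
    exact Finset.sum_congr rfl fun i hi => (ENNReal.ofReal_toReal (hsh i hi)).symm
  have hS : 0 ≤ ∑ i ∈ s, volume.real (shadow (α i) C) :=
    Finset.sum_nonneg fun i _ => measureReal_nonneg
  rw [hsum, ← ENNReal.ofReal_mul (by positivity),
    ← ENNReal.ofReal_toReal hb.measure_lt_top.ne, ← ENNReal.ofReal_add (by positivity)
      (by positivity), ← ENNReal.ofReal_add (by positivity) (by positivity)] at h1
  refine (ENNReal.toReal_le_of_le_ofReal (by positivity) h1).trans (le_of_eq ?_)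
  rw [hR, Measure.real]
  ring

/-- The two facts about the convex hull behind the theorem, up to an error `δ`: a weighted sum `q` of
shadows is at most the perimeter of a connected set, and at the same time it controls both the
perimeter and the area of the convex hull from above, as the hull has the same shadows. -/
lemma exists_between_perimeter {E : Set (EuclideanSpace ℝ (Fin 2))} (hopen : IsOpen E)
    (hconn : IsConnected E) (hb : Bornology.IsBounded E) {δ : ℝ} (hδ0 : 0 < δ) (hδ : δ < 1) :
    ∃ q : ℝ, ENNReal.ofReal q ≤ perimeter E ∧
      perimeter (convexHull ℝ E) ≤ ENNReal.ofReal (q / (1 - δ)) ∧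
      2 * √Real.pi * √(volume.real (convexHull ℝ E)) ≤ q / (1 - δ) := by
  obtain ⟨n, α, c, hc, hα⟩ := exists_directions hδ0
  set C := convexHull ℝ E
  have hCo : IsOpen C := hopen.convexHull
  have hCb : Bornology.IsBounded C := isBounded_convexHull.2 hb
  have hCn : C.Nonempty := hconn.nonempty.mono (subset_convexHull ℝ E)
  obtain ⟨K, hK⟩ := exists_volume_add_closedBall_le α (Finset.range n) hc.le hδ
    (fun v => (hα v).1) hCo (convex_convexHull ℝ E) hCb hCn
  simp only [C, shadow_convexHull _ hconn] at hK
  refine ⟨_, ofReal_mul_sum_volume_shadow_le_perimeter α (Finset.range n) hc.le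
    (fun v => (hα v).2) hopen hb, ?_, ?_⟩
  · refine iSup_le fun φ => iSup_le fun hφ => iSup_le fun hs => iSup_le fun h1 =>
      ENNReal.ofReal_le_ofReal ?_
    obtain ⟨K', t₀, ht₀, hK'⟩ := exists_le_volume_add_closedBall hφ hs h1 hCo.measurableSet
      hCb.measure_lt_top.ne
    refine le_of_forall_mul_le_mul_add_sq (K := K + K') ht₀ fun t ht htt => ?_
    have h2 := hK t ht
    have h3 := (ENNReal.ofReal_le_iff_le_toReal
      (hCb.add isBounded_closedBall).measure_lt_top.ne).1 (hK' t ht htt)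
    simp only [Measure.real] at h2 h3
    simp only [Measure.real]
    linarith
  · refine le_of_forall_mul_le_mul_add_sq (K := K) one_pos fun t ht _ => ?_
    have hv : volume.real (closedBall (0 : EuclideanSpace ℝ (Fin 2)) t) = t ^ 2 * Real.pi := by
      rw [Measure.real, EuclideanSpace.volume_closedBall_fin_two]
      rw [ENNReal.toReal_mul, ENNReal.toReal_pow, ENNReal.toReal_ofReal ht.le,
        ENNReal.toReal_ofReal Real.pi_pos.le]
    have hbm := sq_sqrt_volume_add_le hCo measurableSet_closedBall hCb
      (isBounded_closedBall (x := (0 : EuclideanSpace ℝ (Fin 2))) (r := t))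
      (ENNReal.toReal_pos (hCo.measure_pos _ hCn).ne' hCb.measure_lt_top.ne)
      (by rw [hv]; positivity)
    rw [hv, Real.sqrt_mul (by positivity), Real.sqrt_sq ht.le] at hbm
    have h2 := hbm.trans (hK t ht)
    have h3 : √(volume.real C) ^ 2 = volume.real C := Real.sq_sqrt measureReal_nonneg
    have h4 : 0 ≤ (t * √Real.pi) ^ 2 := sq_nonneg _
    simp only [C] at h2 h3 ⊢
    nlinarith

lemma perimeter_convexHull_ne_top {E : Set (EuclideanSpace ℝ (Fin 2))} (hopen : IsOpen E)
    (hconn : IsConnected E) (hb : Bornology.IsBounded E) : perimeter (convexHull ℝ E) ≠ ∞ := by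
  obtain ⟨q, -, h, -⟩ := exists_between_perimeter hopen hconn hb (δ := 1 / 2) (by norm_num)
    (by norm_num)
  exact ne_top_of_le_ne_top ENNReal.ofReal_ne_top h

lemma le_of_forall_one_sub_mul_le {a b : ℝ} (h : ∀ δ, 0 < δ → δ < 1 → (1 - δ) * a ≤ b) :
    a ≤ b :=
  le_of_forall_mul_le_mul_add_sq (K := a) one_pos fun t h0 h1 => by nlinarith [h t h0 h1]

/-- In the plane, passing to the convex hull does not increase the perimeter of a connected open
set. -/
lemma perimeter_convexHull_le {E : Set (EuclideanSpace ℝ (Fin 2))} (hopen : IsOpen E)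
    (hconn : IsConnected E) (hb : Bornology.IsBounded E) :
    perimeter (convexHull ℝ E) ≤ perimeter E := by
  by_cases htop : perimeter E = ∞
  · simp [htop]
  rw [← ENNReal.toReal_le_toReal (perimeter_convexHull_ne_top hopen hconn hb) htop]
  refine le_of_forall_one_sub_mul_le fun δ h0 h1 => ?_
  obtain ⟨q, hq, h, hi⟩ := exists_between_perimeter hopen hconn hb h0 h1
  have hpos : 0 < 1 - δ := by linarith
  have h2 := ENNReal.toReal_le_of_le_ofReal (le_trans (by positivity) hi) h
  rw [le_div_iff₀ hpos] at h2
  have h3 := (ENNReal.ofReal_le_iff_le_toReal htop).1 hq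
  linarith

/-- The isoperimetric inequality for convex hulls. -/
lemma two_mul_sqrt_pi_mul_sqrt_volume_le {E : Set (EuclideanSpace ℝ (Fin 2))} (hopen : IsOpen E)
    (hconn : IsConnected E) (hb : Bornology.IsBounded E) :
    2 * √Real.pi * √(volume.real (convexHull ℝ E)) ≤ (perimeter (convexHull ℝ E)).toReal := by
  refine le_of_forall_one_sub_mul_le fun δ h0 h1 => ?_
  have hconn' : IsConnected (convexHull ℝ E) :=
    (convex_convexHull ℝ E).isConnected (hconn.nonempty.mono (subset_convexHull ℝ E))
  obtain ⟨q, hq, -, hi⟩ := exists_between_perimeter hopen.convexHull hconn'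
    (isBounded_convexHull.2 hb) h0 h1
  rw [(convex_convexHull ℝ E).convexHull_eq] at hi
  have hpos : 0 < 1 - δ := by linarith
  rw [le_div_iff₀ hpos] at hi
  have h3 := (ENNReal.ofReal_le_iff_le_toReal (perimeter_convexHull_ne_top hopen hconn hb)).1 hq
  linarith

/-! ### Dilations -/

lemma isOpen_image_homothety (x₀ : EuclideanSpace ℝ (Fin 2)) {r : ℝ} (hr : 0 < r)
    {A : Set (EuclideanSpace ℝ (Fin 2))} (hA : IsOpen A) :
    IsOpen (AffineMap.homothety x₀ r '' A) :=
  AffineMap.homothety_isOpenMap x₀ r hr.ne' A hA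

/-- A dilation with ratio `r` multiplies perimeters in the plane by at most `r`. -/
lemma perimeter_image_homothety_le (x₀ : EuclideanSpace ℝ (Fin 2)) {r : ℝ} (hr : 0 < r)
    {A : Set (EuclideanSpace ℝ (Fin 2))} (hA : MeasurableSet A) :
    perimeter (AffineMap.homothety x₀ r '' A) ≤ ENNReal.ofReal r * perimeter A := by
  refine iSup_le fun φ => iSup_le fun hφ => iSup_le fun hs => iSup_le fun h1 => ?_
  let e : EuclideanSpace ℝ (Fin 2) ≃ₜ EuclideanSpace ℝ (Fin 2) :=
    ((Homeomorph.subRight x₀).trans (Homeomorph.smulOfNeZero r hr.ne')).trans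
      (Homeomorph.addRight x₀)
  have he : ⇑(AffineMap.homothety x₀ r) = e := by
    ext y
    simp [e, AffineMap.homothety_apply]
  have hed : ∀ y, HasFDerivAt e (r • ContinuousLinearMap.id ℝ (EuclideanSpace ℝ (Fin 2))) y :=
    fun y => (((hasFDerivAt_id y).sub_const x₀).const_smul r).add_const x₀
  have hec : ContDiff ℝ 1 e :=
    ((contDiff_id.sub contDiff_const).const_smul r).add contDiff_const
  have hdiv : ∀ y, divergence (φ ∘ e) y = r * divergence φ (e y) := by
    intro y
    have := ((hφ.differentiable one_ne_zero) (e y)).hasFDerivAt.comp y (hed y)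
    simp [divergence, this.fderiv, mul_add]
  have hint : ∫ x in AffineMap.homothety x₀ r '' A, divergence φ x =
      r * ∫ x in A, divergence (φ ∘ e) x := by
    rw [he, integral_image_eq_integral_abs_det_fderiv_smul volume hA
      (fun y _ => (hed y).hasFDerivWithinAt) e.injective.injOn]
    simp_rw [hdiv]
    rw [← integral_const_mul]
    refine integral_congr_ae (ae_of_all _ fun y => ?_)
    have hdet : (r • ContinuousLinearMap.id ℝ (EuclideanSpace ℝ (Fin 2))).det = r ^ 2 := by
      simp [ContinuousLinearMap.det]
    simp only [hdet, smul_eq_mul, abs_of_pos (pow_pos hr 2)]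
    ring
  rw [hint, ENNReal.ofReal_mul hr.le]
  gcongr
  exact le_iSup_of_le (φ ∘ e) (le_iSup_of_le (hφ.comp hec)
    (le_iSup_of_le (hs.comp_homeomorph e) (le_iSup_of_le (fun x => h1 _) le_rfl)))

lemma image_homothety_subset {x₀ : EuclideanSpace ℝ (Fin 2)} {r : ℝ} (h0 : 0 ≤ r) (h1 : r ≤ 1)
    {A : Set (EuclideanSpace ℝ (Fin 2))} (hA : Convex ℝ A) (hx : x₀ ∈ A) :
    AffineMap.homothety x₀ r '' A ⊆ A := by
  rintro _ ⟨y, hy, rfl⟩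
  rw [AffineMap.homothety_eq_lineMap]
  exact hA.lineMap_mem hx hy ⟨h0, h1⟩

lemma volume_image_homothety_sqrt_div (x₀ : EuclideanSpace ℝ (Fin 2))
    {A : Set (EuclideanSpace ℝ (Fin 2))} {m : ℝ} (hm : 0 ≤ m) (hA0 : volume A ≠ 0)
    (hA : volume A ≠ ∞) :
    volume (AffineMap.homothety x₀ √(m / volume.real A) '' A) = ENNReal.ofReal m := by
  have hpos : 0 < volume.real A := ENNReal.toReal_pos hA0 hA
  rw [Measure.addHaar_image_homothety, finrank_euclideanSpace_fin,
    Real.sq_sqrt (by positivity), abs_of_nonneg (by positivity),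
    ← ENNReal.ofReal_toReal hA, ← ENNReal.ofReal_mul (by positivity)]
  congr 1
  rw [Measure.real] at hpos ⊢
  field_simp

/-- Two sets of the same finite measure, both contained in `C`, differ from each other by at most
twice what the first one misses of `C`. -/
lemma measure_symmDiff_le_two_mul {Ω : Type*} [MeasurableSpace Ω] {μ : Measure Ω} {E F C : Set Ω}
    (hE : MeasurableSet E) (hF : MeasurableSet F) (hEF : μ F = μ E) (hfin : μ E ≠ ∞)
    (hFC : F ⊆ C) : μ (symmDiff E F) ≤ 2 * μ (C \ E) := by
  have h1 : μ (E \ F) = μ (F \ E) := by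
    have a := measure_sdiff_add_inter (μ := μ) E hF
    have b := measure_sdiff_add_inter (μ := μ) F hE
    rw [inter_comm F E, hEF, ← a] at b
    exact ((ENNReal.add_left_inj (ne_top_of_le_ne_top hfin (measure_mono inter_subset_left))).1
      b).symm
  rw [Set.symmDiff_def]
  refine (measure_union_le _ _).trans ?_
  rw [h1, two_mul]
  gcongr

/-! ### Quantitative comparison with the convex hull -/

lemma sqrt_pi_mul_div_le {a b m M : ℝ} (hm : 0 < m) (hmM : m ≤ M) (hab : b ≤ a)
    (hb : 2 * √Real.pi * √M ≤ b) :
    √Real.pi * (M - m) / (√M * √m) ≤ a / √m - b / √M := by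
  have hM : 0 < M := hm.trans_le hmM
  have hu : 0 < √m := Real.sqrt_pos.2 hm
  have hv : 0 < √M := Real.sqrt_pos.2 hM
  have huv : √m ≤ √M := Real.sqrt_le_sqrt hmM
  have e1 : √m ^ 2 = m := Real.sq_sqrt hm.le
  have e2 : √M ^ 2 = M := Real.sq_sqrt hM.le
  have hp : 0 ≤ √Real.pi := Real.sqrt_nonneg _
  rw [div_sub_div _ _ hu.ne' hv.ne', mul_comm √M √m]
  gcongr
  have h1 : b * √M ≤ a * √M := by gcongr
  have h2 : 2 * √Real.pi * √M * (√M - √m) ≤ b * (√M - √m) :=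
    mul_le_mul_of_nonneg_right hb (by linarith)
  have h3 : √Real.pi * (M - m) ≤ 2 * √Real.pi * √M * (√M - √m) := by
    nth_rw 1 [← e1, ← e2]
    have : 0 ≤ √Real.pi * (√M - √m) ^ 2 := by positivity
    nlinarith
  nlinarith

/-- The two estimates of the symmetric difference are used for hulls of area `M ≤ 2π` and
`M ≥ 2π`, respectively. -/
lemma div_two_mul_sqrt_two_le {a b d p M : ℝ} (hM : Real.pi ≤ M) (hab : b ≤ a)
    (hb : 2 * √Real.pi * √M ≤ b) (hd : d ≤ 2 * (M - Real.pi)) (hd' : d ≤ 2 * Real.pi)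
    (hp : p ≤ √(Real.pi / M) * b) : d / (2 * √2) ≤ a - p := by
  have hpi := Real.pi_pos
  have hM0 : 0 < M := hpi.trans_le hM
  have hu : 0 < √Real.pi := Real.sqrt_pos.2 hpi
  have hv : 0 < √M := Real.sqrt_pos.2 hM0
  have huv : √Real.pi ≤ √M := Real.sqrt_le_sqrt hM
  have e1 : √Real.pi ^ 2 = Real.pi := Real.sq_sqrt hpi.le
  have e2 : √M ^ 2 = M := Real.sq_sqrt hM0.le
  have e3 : √2 ^ 2 = (2 : ℝ) := Real.sq_sqrt (by norm_num)
  have hs : 0 < √(2 : ℝ) := by positivity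
  have hlow : 2 * √Real.pi * (√M - √Real.pi) ≤ a - p := by
    rw [Real.sqrt_div hpi.le] at hp
    have h1 : 2 * √Real.pi * √M * (1 - √Real.pi / √M) ≤ b * (1 - √Real.pi / √M) :=
      mul_le_mul_of_nonneg_right hb (by rw [sub_nonneg]; exact div_le_one_of_le₀ huv hv.le)
    have h2 : 2 * √Real.pi * √M * (1 - √Real.pi / √M) = 2 * √Real.pi * (√M - √Real.pi) := by
      field_simp
    linarith
  refine le_trans ?_ hlow
  rw [div_le_iff₀ (by positivity)]
  rcases le_total M (2 * Real.pi) with h | h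
  · have h1 : √M ≤ √2 * √Real.pi := by
      rw [← Real.sqrt_mul (by norm_num)]; exact Real.sqrt_le_sqrt h
    have h2 : √M + √Real.pi ≤ 2 * (√2 * √Real.pi) := by linarith
    have h3 : (√M - √Real.pi) * (√M + √Real.pi) ≤
        (√M - √Real.pi) * (2 * (√2 * √Real.pi)) :=
      mul_le_mul_of_nonneg_left h2 (by linarith)
    nlinarith
  · have h1 : √2 * √Real.pi ≤ √M := by
      rw [← Real.sqrt_mul (by norm_num)]; exact Real.sqrt_le_sqrt h
    have h2 : √Real.pi * (√2 * √Real.pi - √Real.pi) * √2 ≤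
        √Real.pi * (√M - √Real.pi) * √2 := by gcongr
    have h3 : √Real.pi * (√2 * √Real.pi - √Real.pi) * √2 = Real.pi * (2 - √2) := by
      linear_combination (√2 ^ 2 - √2) * e1 + Real.pi * e3
    have h4 : √2 ≤ 3 / 2 := by
      rw [Real.sqrt_le_left (by norm_num)]; norm_num
    nlinarith

lemma coe_ofReal_le_coe_ofReal_sub {x y z : ℝ} (hy : 0 ≤ y) (hz : 0 ≤ z) (h : z ≤ x - y) :
    ((ENNReal.ofReal z : ℝ≥0∞) : EReal) ≤
      ((ENNReal.ofReal x : ℝ≥0∞) : EReal) - ((ENNReal.ofReal y : ℝ≥0∞) : EReal) := by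
  have hx : 0 ≤ x := by linarith
  rw [EReal.coe_ennreal_ofReal, EReal.coe_ennreal_ofReal, EReal.coe_ennreal_ofReal,
    max_eq_left hx, max_eq_left hy, max_eq_left hz, ← EReal.coe_sub]
  exact_mod_cast h

lemma top_sub_coe_ennreal {y : ℝ≥0∞} (hy : y ≠ ∞) : ((∞ : ℝ≥0∞) : EReal) - (y : EReal) = ⊤ := by
  lift y to NNReal using hy
  exact EReal.top_sub_coe _

theorem mainTheorem6 (E : Set (EuclideanSpace ℝ (Fin 2)))
    (hopen : IsOpen E) (hconn : IsConnected E) (hbdd : Bornology.IsBounded E) :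
    (((perimeter E / volume E ^ (1 / 2 : ℝ) : ℝ≥0∞) : EReal)
        - ((perimeter (convexHull ℝ E) / volume (convexHull ℝ E) ^ (1 / 2 : ℝ) : ℝ≥0∞) : EReal)
      ≥ ((ENNReal.ofReal (Real.sqrt Real.pi) * volume (convexHull ℝ E \ E)
          / (volume (convexHull ℝ E) ^ (1 / 2 : ℝ) * volume E ^ (1 / 2 : ℝ)) : ℝ≥0∞) : EReal)) ∧
    (volume E = ENNReal.ofReal Real.pi → ∀ x₀ ∈ E,
      volume (rescaledHull E x₀) = volume E ∧
      (perimeter E : EReal) - (perimeter (rescaledHull E x₀) : EReal)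
        ≥ ((volume (symmDiff E (rescaledHull E x₀))
            / ENNReal.ofReal (2 * Real.sqrt 2) : ℝ≥0∞) : EReal)) := by
  have hEC := subset_convexHull ℝ E
  have hCo : IsOpen (convexHull ℝ E) := hopen.convexHull
  have hEf : volume E ≠ ∞ := hbdd.measure_lt_top.ne
  have hCf : volume (convexHull ℝ E) ≠ ∞ := (isBounded_convexHull.2 hbdd).measure_lt_top.ne
  have hE0 : volume E ≠ 0 := (hopen.measure_pos _ hconn.nonempty).ne'
  have hC0 : volume (convexHull ℝ E) ≠ 0 := (hCo.measure_pos _ (hconn.nonempty.mono hEC)).ne'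
  have hPC := perimeter_convexHull_ne_top hopen hconn hbdd
  have hle := perimeter_convexHull_le hopen hconn hbdd
  have hiso := two_mul_sqrt_pi_mul_sqrt_volume_le hopen hconn hbdd
  have hm : 0 < volume.real E := ENNReal.toReal_pos hE0 hEf
  have hM : 0 < volume.real (convexHull ℝ E) := ENNReal.toReal_pos hC0 hCf
  have hmM : volume.real E ≤ volume.real (convexHull ℝ E) := measureReal_mono hEC hCf
  have hdiff : volume (convexHull ℝ E \ E) =
      ENNReal.ofReal (volume.real (convexHull ℝ E) - volume.real E) := by
    rw [measure_sdiff hEC hopen.measurableSet.nullMeasurableSet hEf, ENNReal.ofReal_sub _ hm.le,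
      Measure.real, Measure.real, ENNReal.ofReal_toReal hEf, ENNReal.ofReal_toReal hCf]
  refine ⟨?_, fun hpi x₀ hx₀ => ?_⟩
  · have hroot : ∀ A : Set (EuclideanSpace ℝ (Fin 2)), volume A ≠ ∞ →
        volume A ^ (1 / 2 : ℝ) = ENNReal.ofReal √(volume.real A) := by
      intro A hA
      rw [Real.sqrt_eq_rpow, ← ENNReal.ofReal_rpow_of_nonneg measureReal_nonneg (by norm_num),
        Measure.real, ENNReal.ofReal_toReal hA]
    have hu := Real.sqrt_pos.2 hm
    have hv := Real.sqrt_pos.2 hM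
    rw [hroot _ hEf, hroot _ hCf, hdiff, ← ENNReal.ofReal_mul (by positivity),
      ← ENNReal.ofReal_mul (by positivity), ← ENNReal.ofReal_div_of_pos (by positivity)]
    by_cases htop : perimeter E = ∞
    · rw [htop, ENNReal.top_div_of_ne_top ENNReal.ofReal_ne_top, top_sub_coe_ennreal]
      · exact le_top
      · exact ENNReal.div_ne_top hPC (by simpa using hv)
    · rw [← ENNReal.ofReal_toReal htop, ← ENNReal.ofReal_toReal hPC,
        ← ENNReal.ofReal_div_of_pos hu, ← ENNReal.ofReal_div_of_pos hv]
      refine coe_ofReal_le_coe_ofReal_sub (by positivity) ?_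
        (sqrt_pi_mul_div_le hm hmM (ENNReal.toReal_mono htop hle) hiso)
      have := sub_nonneg.2 hmM
      positivity
  · have hmpi : volume.real E = Real.pi := by
      rw [Measure.real, hpi, ENNReal.toReal_ofReal Real.pi_pos.le]
    set θ := √(volume.real E / volume.real (convexHull ℝ E))
    have hθ0 : 0 < θ := Real.sqrt_pos.2 (by positivity)
    have hθ1 : θ ≤ 1 := Real.sqrt_le_one.2 (div_le_one_of_le₀ hmM hM.le)
    have hF : volume (rescaledHull E x₀) = volume E := by
      rw [rescaledHull, volume_image_homothety_sqrt_div x₀ hm.le hC0 hCf, Measure.real,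
        ENNReal.ofReal_toReal hEf]
    have hFo : IsOpen (rescaledHull E x₀) := isOpen_image_homothety x₀ hθ0 hCo
    have hFC : rescaledHull E x₀ ⊆ convexHull ℝ E :=
      image_homothety_subset hθ0.le hθ1 (convex_convexHull ℝ E) (hEC hx₀)
    have hPF : perimeter (rescaledHull E x₀) ≤
        ENNReal.ofReal (θ * (perimeter (convexHull ℝ E)).toReal) := by
      rw [ENNReal.ofReal_mul hθ0.le, ENNReal.ofReal_toReal hPC]
      exact perimeter_image_homothety_le x₀ hθ0 hCo.measurableSet
    have hPFf : perimeter (rescaledHull E x₀) ≠ ∞ := ne_top_of_le_ne_top ENNReal.ofReal_ne_top hPF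
    refine ⟨hF, ?_⟩
    by_cases htop : perimeter E = ∞
    · rw [htop, top_sub_coe_ennreal hPFf]
      exact le_top
    have hD1 := measure_symmDiff_le_two_mul hopen.measurableSet hFo.measurableSet hF hEf hFC
    have hD2 : volume (symmDiff E (rescaledHull E x₀)) ≤ ENNReal.ofReal (2 * Real.pi) := by
      refine (measure_mono symmDiff_subset_union).trans ((measure_union_le _ _).trans ?_)
      rw [hF, hpi, ← ENNReal.ofReal_add Real.pi_pos.le Real.pi_pos.le, two_mul]
    have htwo : ∀ x : ℝ, 2 * ENNReal.ofReal x = ENNReal.ofReal (2 * x) := fun x => by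
      rw [ENNReal.ofReal_mul (by norm_num), ENNReal.ofReal_ofNat]
    rw [hdiff, htwo] at hD1
    have hDf := ne_top_of_le_ne_top ENNReal.ofReal_ne_top hD2
    have hsub := sub_nonneg.2 hmM
    rw [← ENNReal.ofReal_toReal htop, ← ENNReal.ofReal_toReal hPFf, ← ENNReal.ofReal_toReal hDf,
      ← ENNReal.ofReal_div_of_pos (by positivity)]
    refine coe_ofReal_le_coe_ofReal_sub ENNReal.toReal_nonneg (by positivity)
      (div_two_mul_sqrt_two_le (hmpi ▸ hmM) (ENNReal.toReal_mono htop hle) hiso ?_ ?_ ?_)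
    · rw [← hmpi]
      exact ENNReal.toReal_le_of_le_ofReal (by positivity) hD1
    · exact ENNReal.toReal_le_of_le_ofReal (by positivity) hD2
    · rw [← hmpi]
      exact ENNReal.toReal_le_of_le_ofReal (by positivity) hPF

end
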